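/- Let $m\ge 1$ and $n,s\ge 0$ be integers. Draw the triangular lattice in the plane so that one family of lattice lines is vertical, and let it be the projection of the cubic lattice $\mathbb Z^3$ along the line $x=y=z$, the $z$-axis projecting vertically upwards and the $x$-axis to the polar direction $-\pi/6$. A horizontal zigzag is an infinite lattice path whose edges are alternately of slope $+1/\sqrt3$ ("/"-edges) and $-1/\sqrt3$. Let ${\bf v}$ be the shortest nonzero (horizontal) vector translation by which leaves such zigzags invariant, i.e. the projection of $(1,-1,0)$. For $k\ge 0$ let the zigzag strip $Z_k$ be the region between a fixed horizontal zigzag and its translate by $k$ units in the polar direction $-\pi/6$. A lozenge is a union of two unit triangles sharing an edge; it is horizontal if that edge is vertical. Given a "/"-edge on the upper boundary of $Z_k$, a path of lozenges in $Z_k$ starting from it is a sequence of lozenges in which consecutive lozenges share "/"-edges on their boundaries, leading down from the given "/"-edge to a "/"-edge on the lower boundary. A cliff is a stepped surface (a union of unit square faces of the cubic lattice on which the projection is one-to-one) whose projection is the region bounded by two parallel horizontal zigzags; its bounding zigzags lie in horizontal planes, and its height is the difference of the heights of these planes. Its horizontal displacement is $s$ if, for every integer $j$, exactly $s$ of its horizontal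 faces lie between the planes $y=j$ and $y=j+1$. Cliffs are considered with a fixed upper bounding zigzag in space. A cliff is $m$-periodic if it is invariant under translation by $m(1,-1,0)$; a tiling or a family of paths in $Z_k$ is $m$-periodic if it is invariant under translation by $m{\bf v}$. The honeycomb cylinder $H_{2m,N}$ has vertices $(i,x)$, $i\in\mathbb Z/2m$, $0\le x<N$. For each $i$, the vertices $(i,0),\dots,(i,N-1)$ form a path (the $i$-th strand) in this order; moreover, $(i,x)$ and $(i+1,x)$ are joined by a vertical edge whenever $i+x$ is odd. A cylindric partition of shape $\lambda/\mu/d$ is a filling of the skew diagram $\lambda/\mu$ with non-negative integers that weakly decreases along rows and columns, and such that, when a copy of the bottom row, translated $d$ units to the right, is placed above the top row, the extended array still weakly decreases along columns. Proposition 4.2. The following sets are equinumerous: 1. the $m$-periodic cliffs of height $n$ and horizontal displacement $s$; 2. the $m$-periodic lozenge tilings of $Z_{2n+s}$ with exactly $s$ horizontal lozenges along each path of lozenges of the tiling; 3. the perfect matchings of $H_{2m,2n+s}$ with exactly $ms$ vertical edges; 4. the $m$-periodic families of non-intersecting paths of lozenges in $Z_{2n+s}$, one path starting at each "/"-edge of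 the upper boundary, with exactly $s$ horizontal lozenges on each path; 5. the cylindric partitions of shape $(s+m-1,s+m-2,\dots,s)/(m-1,m-2,\dots,0)/m$ with entries at most $n$. -/

import Mathlib

namespace Cliff

/-! ### The cubic lattice, the triangular lattice, and the projection between them -/

/-- Points of the cubic lattice. -/
abbrev Point3 := ℤ × ℤ × ℤ

/-- Points of the triangular lattice, in coordinates with respect to two lattice directions.  The
point `(p, q)` sits at `p • (√3 / 2, - 1 / 2) + q • (- √3 / 2, - 1 / 2)` in the Euclidean plane, so
the six neighbours of a point are reached by adding `(1, 0)`, `(0, 1)`, `(1, 1)` or their negatives,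
and the lattice lines of direction `(1, 1)` are vertical. -/
abbrev Point2 := ℤ × ℤ

/-- The projection of the cubic lattice onto the triangular lattice, along the line `x = y = z`. -/
def proj (v : Point3) : Point2 := (v.1 - v.2.2, v.2.1 - v.2.2)

/-- The three coordinate axes; the `z` axis is the upward direction, so that the faces with normal
`z` are the horizontal ones. -/
inductive Axis
  | x
  | y
  | z

/-- The unit vector of an axis. -/
def Axis.vec : Axis → Point3
  | .x => (1, 0, 0)
  | .y => (0, 1, 0)
  | .z => (0, 0, 1)

/-- The two other axes. -/
def Axis.others : Axis → Axis × Axis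
  | .x => (.y, .z)
  | .y => (.x, .z)
  | .z => (.x, .y)

/-- A unit square face of the cubic lattice: the square with the given normal axis, spanned at
`corner` by the unit vectors of the two other axes. -/
@[ext]
structure Face where
  corner : Point3
  normal : Axis

/-- The four vertices of a face. -/
def Face.vertices (f : Face) : Finset Point3 :=
  {f.corner, f.corner + f.normal.others.1.vec, f.corner + f.normal.others.2.vec,
    f.corner + f.normal.others.1.vec + f.normal.others.2.vec}

/-- Translation of faces. -/
def Face.translate (w : Point3) (f : Face) : Face := ⟨f.corner + w, f.normal⟩

/-- A lozenge of the triangular lattice (a union of two unit triangles sharing an edge): the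
parallelogram spanned at `corner` by the projections of the unit vectors of the two axes other than
`normal`. Every lozenge arises so from exactly one `corner` and `normal`. -/
@[ext]
structure Lozenge where
  corner : Point2
  normal : Axis

/-- The four vertices of a lozenge. -/
def Lozenge.vertices (L : Lozenge) : Finset Point2 :=
  {L.corner, L.corner + proj L.normal.others.1.vec, L.corner + proj L.normal.others.2.vec,
    L.corner + proj L.normal.others.1.vec + proj L.normal.others.2.vec}

/-- The horizontal lozenges, i.e. those whose long diagonal is horizontal: they consist of two
triangles sharing a vertical edge, and are the projections of horizontal faces. -/
def Lozenge.isHorizontal (L : Lozenge) : Bool :=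
  match L.normal with
  | .z => true
  | _ => false

/-- Translation of lozenges. -/
def Lozenge.translate (w : Point2) (L : Lozenge) : Lozenge := ⟨L.corner + w, L.normal⟩

/-- The unit triangles of the triangular lattice. Each has exactly one vertical edge, whose upper
end we call `P` here; the triangle lies to the left or to the right of that edge. -/
inductive Triangle
  | left (P : Point2)
  | right (P : Point2)

/-- The three vertices of a unit triangle. -/
def Triangle.vertices : Triangle → Finset Point2
  | .left P => {P, P + (0, 1), P + (1, 1)}
  | .right P => {P, P + (1, 0), P + (1, 1)}

/-! ### Zigzags and zigzag strips -/

/-- The level of a lattice point: the height of `P` in the Euclidean plane is `- level P / 2`. -/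
def level (P : Point2) : ℤ := P.1 + P.2

/-- The lattice points on an infinite horizontal zigzag. The edges of the zigzag are the
non-vertical lattice edges between its points; each lattice point of level `a` is joined to the two
neighbouring lattice points of level `a + 1`. Translation by `k` units along `(1, 0)` (or along
`(0, 1)`) takes `zigzag a` to `zigzag (a + k)`, and `(1, - 1)` is a shortest non-zero vector the
translation by which leaves zigzags invariant. -/
def zigzag (a : ℤ) : Set Point2 := {P | level P = a ∨ level P = a + 1}

/-- The lattice points of the zigzag strip between `zigzag 0` and its translate `zigzag k`, both
included. As the vertices of a unit triangle have three consecutive levels, a unit triangle or a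
lozenge lies in the strip if and only if all its vertices are among these points. -/
def strip (k : ℕ) : Set Point2 := {P | 0 ≤ level P ∧ level P ≤ k + 1}

/-! ### Cliffs -/

/-- The lattice points of an infinite zigzag in the horizontal plane of height `h` in space, with
edges parallel to the `x` and `y` axes. -/
def zigzag3 (a h : ℤ) : Set Point3 := {v | (v.1 + v.2.1 = a ∨ v.1 + v.2.1 = a + 1) ∧ v.2.2 = h}

/-- `IsCliff n F`: the set `F` of faces is a cliff of height `n`, placed so that its upper bounding
zigzag is `zigzag3 0 0`. The lower bounding zigzag is then contained in the plane of height `-n`.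
That `F` is a stepped surface is expressed by saying that the projection, restricted to the
surface with its bounding zigzags, is one-to-one onto the region between the projected zigzags:
the projections of the faces in `F` tile that region, and whenever vertices of the surface have the
same projection, they are equal (so faces with neighbouring projections are glued in space). -/
def IsCliff (n : ℕ) (F : Set Face) : Prop :=
  ∃ (k : ℕ) (a : ℤ),
    proj '' zigzag3 0 0 = zigzag 0 ∧
    proj '' zigzag3 a (-n) = zigzag k ∧
    (∀ f ∈ F, ∀ v ∈ f.vertices, proj v ∈ strip k) ∧
    (∀ t : Triangle, (∀ P ∈ t.vertices, P ∈ strip k) →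
      ∃! f : Face, f ∈ F ∧ t.vertices ⊆ f.vertices.image proj) ∧
    Set.InjOn proj ({v | ∃ f ∈ F, v ∈ f.vertices} ∪ zigzag3 0 0 ∪ zigzag3 a (-n))

/-- Each slice of `F`, between two planes `y = j` and `y = j + 1`, has exactly `s` horizontal
faces. -/
def HasHorizontalDisplacement (s : ℕ) (F : Set Face) : Prop :=
  ∀ j : ℤ, {f | f ∈ F ∧ f.normal = .z ∧ f.corner.2.1 = j}.encard = s

/-- The `m`-periodic cliffs of height `n` and horizontal displacement `s` (with fixed upper bounding
zigzag). -/
def periodicCliffs (m n s : ℕ) : Set (Set Face) :=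
  {F | IsCliff n F ∧ HasHorizontalDisplacement s F ∧
    ∀ f : Face, f ∈ F ↔ f.translate ((m : ℤ), -(m : ℤ), 0) ∈ F}

/-! ### Lozenge tilings and paths of lozenges -/

/-- `T` is a lozenge tiling of the zigzag strip between `zigzag 0` and `zigzag k`. -/
def IsLozengeTiling (k : ℕ) (T : Set Lozenge) : Prop :=
  (∀ L ∈ T, ∀ P ∈ L.vertices, P ∈ strip k) ∧
  ∀ t : Triangle, (∀ P ∈ t.vertices, P ∈ strip k) →
    ∃! L : Lozenge, L ∈ T ∧ t.vertices ⊆ L.vertices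

/-- A slash edge is a lattice edge joining some `Q` to `Q + (0, 1)`; we name it by `Q`.
`SlashStep L Q R` says that the lozenge `L` has slash edges on its boundary, `Q` being the upper
and `R` the lower one. There are two kinds of such lozenges: the horizontal ones, and those with
vertical sides. -/
inductive SlashStep : Lozenge → Point2 → Point2 → Prop
  | horizontal (Q : Point2) : SlashStep ⟨Q, .z⟩ Q (Q + (1, 0))
  | vertical (Q : Point2) : SlashStep ⟨Q + (1, 1), .x⟩ Q (Q + (1, 1))

/-- The lozenges of the list, in this order, lead from the slash edge `Q` down to the slash
edge `R`. -/
inductive SlashPath : Point2 → List Lozenge → Point2 → Prop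
  | nil (Q : Point2) : SlashPath Q [] Q
  | cons {L : Lozenge} {l : List Lozenge} {Q Q₁ R : Point2} :
      SlashStep L Q Q₁ → SlashPath Q₁ l R → SlashPath Q (L :: l) R

/-- The list `l` is a path of lozenges in the zigzag strip between `zigzag 0` and `zigzag k`, from
the slash edge of the upper boundary indexed by `i`, with end points `(i, - i)` and `(i, - i + 1)`,
to a slash edge of the lower boundary. -/
def IsLozengePath (k : ℕ) (i : ℤ) (l : List Lozenge) : Prop :=
  (∃ R : Point2, level R = k ∧ SlashPath (i, -i) l R) ∧
  ∀ L ∈ l, ∀ P ∈ L.vertices, P ∈ strip k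

/-- The `m`-periodic lozenge tilings of the zigzag strip between `zigzag 0` and `zigzag k`, such
that every path of lozenges of the tiling has exactly `s` horizontal lozenges. -/
def periodicTilings (m k s : ℕ) : Set (Set Lozenge) :=
  {T | IsLozengeTiling k T ∧
    (∀ (i : ℤ) (l : List Lozenge), IsLozengePath k i l → (∀ L ∈ l, L ∈ T) →
      l.countP Lozenge.isHorizontal = s) ∧
    ∀ L : Lozenge, L ∈ T ↔ L.translate ((m : ℤ), -(m : ℤ)) ∈ T}

/-- The `m`-periodic families of non-intersecting paths of lozenges in the zigzag strip between
`zigzag 0` and `zigzag k`, one path for each slash edge of the upper boundary, with `s` horizontal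
lozenges on each path. Paths are non-intersecting if no unit triangle is covered by both. -/
def periodicPathFamilies (m k s : ℕ) : Set (ℤ → List Lozenge) :=
  {p | (∀ i, IsLozengePath k i (p i) ∧ (p i).countP Lozenge.isHorizontal = s) ∧
    (∀ i j, i ≠ j → ∀ L ∈ p i, ∀ L' ∈ p j, ∀ t : Triangle,
      ¬ (t.vertices ⊆ L.vertices ∧ t.vertices ⊆ L'.vertices)) ∧
    ∀ i, p (i + m) = (p i).map (Lozenge.translate ((m : ℤ), -(m : ℤ)))}

/-! ### Honeycomb cylinders -/

/-- The vertices of the honeycomb cylinder with `2 * m` strands of `N` vertices: the strand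
(cyclically indexed, from bottom to top) and the position in the strand (from left to right). -/
abbrev HoneycombVertex (m N : ℕ) := ZMod (2 * m) × Fin N

/-- Along a strand, bottom and top vertices alternate; above a top vertex of a strand there is a
bottom vertex of the next strand, so that the strands are alternately of two kinds. -/
def IsTop {m N : ℕ} (a : HoneycombVertex m N) : Prop := Odd (a.1.val + a.2.val)

/-- The honeycomb cylinder graph with `2 * m` strands, each a path with `N` vertices. Top vertices of
each strand are joined by a vertical edge to the bottom vertices just above in the next strand
(cyclically). -/
def honeycombCylinder (m N : ℕ) : SimpleGraph (HoneycombVertex m N) :=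
  SimpleGraph.fromRel fun a b =>
    (b.1 = a.1 ∧ b.2.val = a.2.val + 1) ∨ (IsTop a ∧ b.1 = a.1 + 1 ∧ b.2 = a.2)

/-- The vertical edges of the honeycomb cylinder. -/
def verticalEdges (m N : ℕ) : Set (Sym2 (HoneycombVertex m N)) :=
  {e | ∃ a : HoneycombVertex m N, IsTop a ∧ e = s(a, (a.1 + 1, a.2))}

/-- The perfect matchings of the honeycomb cylinder with `2 * m` strands of `N` vertices that have
exactly `r` vertical edges. -/
def matchingsWithVertical (m N r : ℕ) : Set (honeycombCylinder m N).Subgraph :=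
  {M | M.IsPerfectMatching ∧ (M.edgeSet ∩ verticalEdges m N).encard = r}

/-! ### Cylindric partitions -/

/-- Cylindric partitions of shape `lam / mu / d`: fillings of the skew diagram `lam / mu` with
non-negative integers (continued by `0` outside of the skew diagram) which decrease weakly along rows
and columns, also after a copy of the bottom row, translated `d` units to the right, has been put
above the top row. Cells are written `(row, column)`, both counted from `0`; the bottom row is the
row `lam.colLen 0 - 1`. -/
structure CylindricPartition (lam mu : YoungDiagram) (d : ℕ) where
  entry : ℕ × ℕ → ℕ
  zero_outside : ∀ c, ¬ (c ∈ lam ∧ c ∉ mu) → entry c = 0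
  row_weak : ∀ i j j', j < j' → (i, j) ∈ lam → (i, j) ∉ mu → (i, j') ∈ lam → (i, j') ∉ mu →
    entry (i, j') ≤ entry (i, j)
  col_weak : ∀ i i' j, i < i' → (i, j) ∈ lam → (i, j) ∉ mu → (i', j) ∈ lam → (i', j) ∉ mu →
    entry (i', j) ≤ entry (i, j)
  wrap_weak : ∀ b i j, b + 1 = lam.colLen 0 → (b, j) ∈ lam → (b, j) ∉ mu →
    (i, j + d) ∈ lam → (i, j + d) ∉ mu → entry (i, j + d) ≤ entry (b, j)

/-- The Young diagram with row lengths `(s + m - 1, s + m - 2, ..., s)`. -/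
def stairs (m s : ℕ) : YoungDiagram :=
  YoungDiagram.ofRowLens ((List.range m).reverse.map (s + ·)) <| by
    rw [List.sortedGE_iff_pairwise, List.pairwise_map, List.pairwise_reverse]
    exact List.pairwise_lt_range.imp fun h => by omega

/-- The cylindric partitions of shape `(s + m - 1, ..., s + 1, s) / (m - 1, ..., 1, 0) / m` with all
entries at most `n`. -/
def boundedCylindricPartitions (m n s : ℕ) : Set (CylindricPartition (stairs m s) (stairs m 0) m) :=
  {π | ∀ c, π.entry c ≤ n}

end Cliff

/-!
All five kinds of objects are compared with lozenge tilings of the strip, and these are regarded as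
perfect matchings between the left and the right unit triangles (`isLozengeTiling_iff`).

*Heights.* Around each unit triangle exactly one of the three edges is the short diagonal of a
lozenge of the tiling. Therefore a tiling `T` of the strip between `zigzag 0` and `zigzag k` has a
height function `height T`: along lattice edges of the directions `(1, 0)` and `(0, 1)` it changes
only across lozenges with normals `x` and `y`, respectively (`height_add_x`, `height_add_y`), and
along vertical edges it changes except across horizontal lozenges (`height_add_xy`). It vanishes on
the upper boundary and is constant, say `-n'`, on the lower one. A path of lozenges descends by one
unit with each of its non-horizontal lozenges, so every path of the tiling has exactly `k - 2 n'`
horizontal lozenges (`countP_path`). With `k = 2 n + s`, the condition on the paths thus becomes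
`n' = n`.

*Cliffs.* Lifting the lozenges of a tiling to the prescribed heights gives a stepped surface, and
the heights of a given cliff are forced, starting from its upper bounding zigzag
(`isCliff_surface`, `IsCliff.exists_tiling`). The horizontal faces in a slice lie above the
horizontal lozenges of one path (`encard_slice`), which determines `k` from the displacement.

*Matchings.* The honeycomb cylinder is the dual graph of the strip modulo the period, horizontal
lozenges corresponding to vertical edges. Summing height differences over all vertical edges of the
lattice in a period, one finds `m (k - 2 n')` horizontal lozenges (`sum_ind`), so that having `m s`
of them again amounts to `n' = n`.

*Families of paths.* The paths of a tiling cover all lozenges except those with normal `y`.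
Conversely, the gaps between non-intersecting paths can be filled with such lozenges
(`isLozengeTiling_familyLozenges`): a slash edge inside the strip is entered by a path if and only
if it is left by a path, and the paths, which are all of the same shape up to the order of steps,
reach every slash edge of the lower boundary.

*Cylindric partitions.* A path is a word with `s` horizontal and `n` other letters, and is encoded
by the numbers of non-horizontal letters after each horizontal one (`falsesAfter`). These form a
weakly decreasing sequence bounded by `n`. Adjacent paths do not meet if and only if the sequences
satisfy the column condition of cylindric partitions (`wordPath_disjoint_iff`,
`forall_falses_le_iff`), the periodicity of the family accounting for the condition on the copy of
the bottom row.
-/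

namespace Cliff

/-! ### Lozenges as pairs of triangles -/

/-- The point `P` such that `Triangle.left P` is contained in the lozenge. The left triangle `P`
lies just below the slash edge named `P`, and the right triangle `P` just above the slash
edge `P + (1, 0)`. -/
def Lozenge.leftPt : Lozenge → Point2
  | ⟨C, .x⟩ => (C.1 - 1, C.2 - 1)
  | ⟨C, .y⟩ => (C.1, C.2 - 1)
  | ⟨C, .z⟩ => C

/-- The point `P` such that `Triangle.right P` is contained in the lozenge. -/
def Lozenge.rightPt : Lozenge → Point2
  | ⟨C, .x⟩ => (C.1 - 1, C.2)
  | ⟨C, .y⟩ => (C.1 - 1, C.2 - 1)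
  | ⟨C, .z⟩ => C

/-- `L` lies in the strip between `zigzag 0` and `zigzag k`, expressed through the levels of its two
triangles. -/
def Lozenge.InStrip (k : ℕ) (L : Lozenge) : Prop :=
  0 ≤ level L.leftPt ∧ level L.leftPt < k ∧ 0 ≤ level L.rightPt ∧ level L.rightPt < k

theorem left_subset_iff (P : Point2) (L : Lozenge) :
    (Triangle.left P).vertices ⊆ L.vertices ↔ L.leftPt = P := by
  obtain ⟨p, q⟩ := P
  obtain ⟨⟨a, b⟩, ν⟩ := L
  cases ν <;>
    simp [Triangle.vertices, Lozenge.vertices, Lozenge.leftPt, Finset.insert_subset_iff,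
      Axis.others, Axis.vec, proj] <;> omega

theorem right_subset_iff (P : Point2) (L : Lozenge) :
    (Triangle.right P).vertices ⊆ L.vertices ↔ L.rightPt = P := by
  obtain ⟨p, q⟩ := P
  obtain ⟨⟨a, b⟩, ν⟩ := L
  cases ν <;>
    simp [Triangle.vertices, Lozenge.vertices, Lozenge.rightPt, Finset.insert_subset_iff,
      Axis.others, Axis.vec, proj] <;> omega

theorem left_in_strip_iff (k : ℕ) (P : Point2) :
    (∀ Q ∈ (Triangle.left P).vertices, Q ∈ strip k) ↔ 0 ≤ level P ∧ level P < k := by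
  obtain ⟨p, q⟩ := P
  simp [Triangle.vertices, strip, level]
  omega

theorem right_in_strip_iff (k : ℕ) (P : Point2) :
    (∀ Q ∈ (Triangle.right P).vertices, Q ∈ strip k) ↔ 0 ≤ level P ∧ level P < k := by
  obtain ⟨p, q⟩ := P
  simp [Triangle.vertices, strip, level]
  omega

theorem lozenge_in_strip_iff (k : ℕ) (L : Lozenge) :
    (∀ P ∈ L.vertices, P ∈ strip k) ↔ L.InStrip k := by
  obtain ⟨⟨a, b⟩, ν⟩ := L
  cases ν <;>
    simp [Lozenge.vertices, Lozenge.InStrip, Lozenge.leftPt, Lozenge.rightPt, strip, level,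
      Axis.others, Axis.vec, proj] <;> omega

/-- A lozenge tiling is a perfect matching between left and right unit triangles. -/
theorem isLozengeTiling_iff (k : ℕ) (T : Set Lozenge) :
    IsLozengeTiling k T ↔ (∀ L ∈ T, L.InStrip k) ∧
      (∀ P, 0 ≤ level P → level P < k → ∃! L : Lozenge, L ∈ T ∧ L.leftPt = P) ∧
      ∀ P, 0 ≤ level P → level P < k → ∃! L : Lozenge, L ∈ T ∧ L.rightPt = P := by
  simp only [IsLozengeTiling, lozenge_in_strip_iff]
  refine and_congr_right fun _ => ⟨fun h => ⟨fun P h0 hk => ?_, fun P h0 hk => ?_⟩, ?_⟩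
  · simpa only [left_subset_iff] using h (.left P) ((left_in_strip_iff k P).2 ⟨h0, hk⟩)
  · simpa only [right_subset_iff] using h (.right P) ((right_in_strip_iff k P).2 ⟨h0, hk⟩)
  · rintro ⟨hl, hr⟩ (P | P) hP
    · simp only [left_subset_iff]
      exact hl P ((left_in_strip_iff k P).1 hP).1 ((left_in_strip_iff k P).1 hP).2
    · simp only [right_subset_iff]
      exact hr P ((right_in_strip_iff k P).1 hP).1 ((right_in_strip_iff k P).1 hP).2

theorem eq_of_leftPt_eq {k : ℕ} {T : Set Lozenge} (hT : IsLozengeTiling k T) {L L' : Lozenge}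
    (hL : L ∈ T) (hL' : L' ∈ T) (h : L.leftPt = L'.leftPt) : L = L' := by
  rw [isLozengeTiling_iff] at hT
  have hs := hT.1 L' hL'
  exact (hT.2.1 _ hs.1 hs.2.1).unique ⟨hL, h⟩ ⟨hL', rfl⟩

theorem eq_of_rightPt_eq {k : ℕ} {T : Set Lozenge} (hT : IsLozengeTiling k T) {L L' : Lozenge}
    (hL : L ∈ T) (hL' : L' ∈ T) (h : L.rightPt = L'.rightPt) : L = L' := by
  rw [isLozengeTiling_iff] at hT
  have hs := hT.1 L' hL'
  exact (hT.2.2 _ hs.2.2.1 hs.2.2.2).unique ⟨hL, h⟩ ⟨hL', rfl⟩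

theorem eq_of_leftPt_eq_of_rightPt_eq {L L' : Lozenge} (hl : L.leftPt = L'.leftPt)
    (hr : L.rightPt = L'.rightPt) : L = L' := by
  obtain ⟨⟨a, b⟩, ν⟩ := L
  obtain ⟨⟨a', b'⟩, ν'⟩ := L'
  cases ν <;> cases ν' <;> simp [Lozenge.leftPt, Lozenge.rightPt] at hl hr ⊢ <;> omega

theorem leftPt_translate (w : Point2) (L : Lozenge) :
    (L.translate w).leftPt = L.leftPt + w := by
  obtain ⟨⟨a, b⟩, ν⟩ := L
  obtain ⟨c, d⟩ := w
  cases ν <;> simp [Lozenge.leftPt, Lozenge.translate] <;> omega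

theorem rightPt_translate (w : Point2) (L : Lozenge) :
    (L.translate w).rightPt = L.rightPt + w := by
  obtain ⟨⟨a, b⟩, ν⟩ := L
  obtain ⟨c, d⟩ := w
  cases ν <;> simp [Lozenge.rightPt, Lozenge.translate] <;> omega

/-- The three lozenges that contain a given left triangle. -/
theorem leftPt_eq_iff (L : Lozenge) (p q : ℤ) :
    L.leftPt = (p, q) ↔ L = ⟨(p, q), .z⟩ ∨ L = ⟨(p + 1, q + 1), .x⟩ ∨ L = ⟨(p, q + 1), .y⟩ := by
  obtain ⟨⟨a, b⟩, ν⟩ := L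
  cases ν <;> simp [Lozenge.leftPt] <;> omega

/-- The three lozenges that contain a given right triangle. -/
theorem rightPt_eq_iff (L : Lozenge) (p q : ℤ) :
    L.rightPt = (p, q) ↔ L = ⟨(p, q), .z⟩ ∨ L = ⟨(p + 1, q), .x⟩ ∨ L = ⟨(p + 1, q + 1), .y⟩ := by
  obtain ⟨⟨a, b⟩, ν⟩ := L
  cases ν <;> simp [Lozenge.rightPt] <;> omega

/-! ### Paths of lozenges -/

/-- A lozenge with normal `x` or `z` leads from the upper edge of its left triangle to the lower
edge of its right triangle. -/
theorem slashStep_iff (L : Lozenge) (Q R : Point2) :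
    SlashStep L Q R ↔ L.normal ≠ .y ∧ L.leftPt = Q ∧ L.rightPt + (1, 0) = R := by
  obtain ⟨⟨a, b⟩, ν⟩ := L
  constructor
  · rintro (_ | _) <;> simp [Lozenge.leftPt, Lozenge.rightPt, Prod.ext_iff]
  · rintro ⟨hν, rfl, rfl⟩
    cases ν
    · have := SlashStep.vertical (a - 1, b - 1)
      simpa [Lozenge.leftPt, Lozenge.rightPt] using this
    · exact absurd rfl hν
    · exact SlashStep.horizontal (a, b)

theorem level_add_one (P : Point2) : level (P + (1, 0)) = level P + 1 := by
  simp [level]; ring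

theorem level_leftPt_le {L : Lozenge} (h : L.normal ≠ .y) :
    level L.leftPt ≤ level L.rightPt := by
  obtain ⟨⟨a, b⟩, ν⟩ := L
  cases ν <;> simp [Lozenge.leftPt, Lozenge.rightPt, level] at h ⊢

theorem SlashPath.append {Q R S : Point2} {l l' : List Lozenge} (h : SlashPath Q l R)
    (h' : SlashPath R l' S) : SlashPath Q (l ++ l') S := by
  induction h with
  | nil => exact h'
  | cons hs _ ih => exact .cons hs (ih h')

theorem SlashPath.level_le {Q R : Point2} {l : List Lozenge} (h : SlashPath Q l R) :
    level Q ≤ level R := by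
  induction h with
  | nil => exact le_rfl
  | cons hs _ ih =>
    obtain ⟨h1, rfl, rfl⟩ := (slashStep_iff _ _ _).1 hs
    have := level_leftPt_le h1
    rw [level_add_one] at ih
    omega

theorem SlashPath.level_of_mem {Q R : Point2} {l : List Lozenge} (h : SlashPath Q l R)
    {L : Lozenge} (hL : L ∈ l) :
    L.normal ≠ .y ∧ level Q ≤ level L.leftPt ∧ level L.rightPt < level R := by
  induction h with
  | nil => simp at hL
  | cons hs hp ih =>
    obtain ⟨h1, rfl, rfl⟩ := (slashStep_iff _ _ _).1 hs
    have h2 := level_leftPt_le h1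
    have h3 := hp.level_le
    rw [level_add_one] at h3
    rcases List.mem_cons.1 hL with rfl | hL
    · exact ⟨h1, le_rfl, by omega⟩
    · have := ih hL
      rw [level_add_one] at this
      exact ⟨this.1, by omega, this.2.2⟩

/-- The levels along a path increase. -/
theorem SlashPath.nodup {Q R : Point2} {l : List Lozenge} (h : SlashPath Q l R) : l.Nodup := by
  induction h with
  | nil => exact List.nodup_nil
  | cons hs hp ih =>
    obtain ⟨h1, rfl, rfl⟩ := (slashStep_iff _ _ _).1 hs
    refine List.nodup_cons.2 ⟨fun hm => ?_, ih⟩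
    have h2 := level_leftPt_le h1
    have h3 := (hp.level_of_mem hm).2.1
    rw [level_add_one] at h3
    omega

theorem level_diag (i : ℤ) : level (i, -i) = 0 := by simp [level]

/-- A path of lozenges between the boundaries automatically stays in the strip. -/
theorem isLozengePath_iff (k : ℕ) (i : ℤ) (l : List Lozenge) :
    IsLozengePath k i l ↔ ∃ R : Point2, level R = k ∧ SlashPath (i, -i) l R := by
  refine ⟨fun h => h.1, fun ⟨R, hR, h⟩ => ⟨⟨R, hR, h⟩, fun L hL => ?_⟩⟩
  rw [lozenge_in_strip_iff]
  have h1 := h.level_of_mem hL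
  have h2 := level_leftPt_le h1.1
  rw [level_diag] at h1
  exact ⟨by omega, by omega, by omega, by omega⟩

/-- Each slash edge that is entered from above is left downwards, unless it is the last one. -/
theorem SlashPath.exists_leftPt_eq {Q R : Point2} {l : List Lozenge} (h : SlashPath Q l R)
    {L : Lozenge} (hL : L ∈ l) (hR : L.rightPt + (1, 0) ≠ R) :
    ∃ L' ∈ l, L'.leftPt = L.rightPt + (1, 0) := by
  induction h with
  | nil => simp at hL
  | cons hs hp ih =>
    obtain ⟨h1, rfl, rfl⟩ := (slashStep_iff _ _ _).1 hs
    rcases List.mem_cons.1 hL with rfl | hL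
    · cases hp with
      | nil => exact absurd rfl hR
      | cons hs' hp' =>
        exact ⟨_, List.mem_cons_of_mem _ List.mem_cons_self, ((slashStep_iff _ _ _).1 hs').2.1⟩
    · obtain ⟨L', hL', h⟩ := ih hL hR
      exact ⟨L', List.mem_cons_of_mem _ hL', h⟩

/-- Each slash edge that is left downwards has been entered from above, unless it is the
first one. -/
theorem SlashPath.exists_rightPt_eq {Q R : Point2} {l : List Lozenge} (h : SlashPath Q l R)
    {L : Lozenge} (hL : L ∈ l) (hQ : L.leftPt ≠ Q) :
    ∃ L' ∈ l, L'.rightPt + (1, 0) = L.leftPt := by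
  induction h with
  | nil => simp at hL
  | @cons L₀ l Q Q₁ R hs hp ih =>
    obtain ⟨h1, rfl, rfl⟩ := (slashStep_iff _ _ _).1 hs
    rcases List.mem_cons.1 hL with rfl | hL
    · exact absurd rfl hQ
    · by_cases h : L.leftPt = L₀.rightPt + (1, 0)
      · exact ⟨L₀, List.mem_cons_self, h.symm⟩
      · obtain ⟨L', hL', h⟩ := ih hL h
        exact ⟨L', List.mem_cons_of_mem _ hL', h⟩

/-- The first slash edge of a nonempty path is left downwards. -/
theorem SlashPath.exists_leftPt_eq_start {Q R : Point2} {l : List Lozenge} (h : SlashPath Q l R)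
    (hQR : Q ≠ R) : ∃ L ∈ l, L.leftPt = Q := by
  cases h with
  | nil => exact absurd rfl hQR
  | cons hs _ => exact ⟨_, List.mem_cons_self, ((slashStep_iff _ _ _).1 hs).2.1⟩

theorem SlashPath.exists_rightPt_eq_end {Q R : Point2} {l : List Lozenge} (h : SlashPath Q l R)
    (hQR : Q ≠ R) : ∃ L ∈ l, L.rightPt + (1, 0) = R := by
  induction h with
  | nil => exact absurd rfl hQR
  | @cons L₀ l Q Q₁ R hs hp ih =>
    by_cases h : Q₁ = R
    · exact ⟨L₀, List.mem_cons_self, ((slashStep_iff _ _ _).1 hs).2.2.trans h⟩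
    · obtain ⟨L', hL', h⟩ := ih h
      exact ⟨L', List.mem_cons_of_mem _ hL', h⟩

/-- The end point of a path is determined by the numbers of steps of the two kinds: each lozenge
leads one unit along `(1, 0)`, and those which are not horizontal also lead one unit
along `(0, 1)`. -/
theorem SlashPath.end_eq {Q R : Point2} {l : List Lozenge} (h : SlashPath Q l R) :
    R = Q + ((l.length : ℤ), (l.length : ℤ) - l.countP Lozenge.isHorizontal) := by
  induction h with
  | nil => simp
  | @cons L₀ l Q Q₁ R hs hp ih =>
    rw [ih]
    cases hs
    · rw [List.countP_cons_of_pos rfl]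
      simp [Prod.ext_iff]
      omega
    · rw [List.countP_cons_of_neg (by simp [Lozenge.isHorizontal])]
      simp [Prod.ext_iff]
      omega

/-! ### The paths of a tiling -/

/-- Two paths of lozenges of a tiling that start at the same slash edge agree. -/
theorem SlashPath.unique {k : ℕ} {T : Set Lozenge} (hT : IsLozengeTiling k T) {Q R R' : Point2}
    {l l' : List Lozenge} (h : SlashPath Q l R) (h' : SlashPath Q l' R') (hl : ∀ L ∈ l, L ∈ T)
    (hl' : ∀ L ∈ l', L ∈ T) (hR : level R = level R') : l = l' := by
  induction h generalizing l' with
  | nil =>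
    cases h' with
    | nil => rfl
    | cons hs hp =>
      obtain ⟨h1, rfl, rfl⟩ := (slashStep_iff _ _ _).1 hs
      have h2 := level_leftPt_le h1
      have h3 := hp.level_le
      rw [level_add_one] at h3
      omega
  | cons hs hp ih =>
    obtain ⟨h1, h2, rfl⟩ := (slashStep_iff _ _ _).1 hs
    cases h' with
    | nil =>
      have h3 := level_leftPt_le h1
      have h4 := hp.level_le
      rw [level_add_one] at h4
      rw [h2] at h3
      omega
    | cons hs' hp' =>
      obtain ⟨h1', h2', rfl⟩ := (slashStep_iff _ _ _).1 hs'
      obtain rfl := eq_of_leftPt_eq hT (hl _ List.mem_cons_self) (hl' _ List.mem_cons_self)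
        (h2.trans h2'.symm)
      rw [ih hp' (fun L hL => hl L (List.mem_cons_of_mem _ hL))
        (fun L hL => hl' L (List.mem_cons_of_mem _ hL)) hR]

theorem leftPt_of_normal_eq_y {L : Lozenge} (h : L.normal = .y) :
    L.leftPt = L.rightPt + (1, 0) := by
  obtain ⟨⟨a, b⟩, ν⟩ := L
  cases ν <;> simp [Lozenge.leftPt, Lozenge.rightPt] at h ⊢

/-- From a slash edge that does not cut a lozenge of the tiling, a path of lozenges of the tiling
leads down to the lower boundary. -/
theorem exists_path_down {k : ℕ} {T : Set Lozenge} (hT : IsLozengeTiling k T) {Q : Point2}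
    (h0 : 0 ≤ level Q) (hk : level Q ≤ k) (hQ : ∀ L ∈ T, L.leftPt = Q → L.normal ≠ .y) :
    ∃ l R, level R = k ∧ SlashPath Q l R ∧ ∀ L ∈ l, L ∈ T := by
  obtain ⟨d, hd⟩ : ∃ d : ℕ, level Q + d = k := ⟨(k - level Q).toNat, by omega⟩
  induction d using Nat.strong_induction_on generalizing Q with
  | _ d ih =>
    rcases hk.eq_or_lt with hk | hk
    · exact ⟨[], Q, hk, .nil Q, by simp⟩
    obtain ⟨L, ⟨hL, hLQ⟩, -⟩ := ((isLozengeTiling_iff k T).1 hT).2.1 Q h0 hk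
    have hy := hQ L hL hLQ
    have h1 := level_leftPt_le hy
    have h2 := ((isLozengeTiling_iff k T).1 hT).1 L hL
    rw [hLQ] at h1
    have h3 := level_add_one L.rightPt
    have h4 := h2.2.2.2
    obtain ⟨l, R, hR, hp, hl⟩ := ih (k - level (L.rightPt + (1, 0))).toNat (by omega)
      (Q := L.rightPt + (1, 0)) (by omega) (by omega)
      (fun L' hL' he hy' => hy (by
        rw [leftPt_of_normal_eq_y hy'] at he
        rwa [← eq_of_rightPt_eq hT hL' hL (add_right_cancel he)])) (by omega)
    refine ⟨L :: l, R, hR, .cons ((slashStep_iff _ _ _).2 ⟨hy, hLQ, rfl⟩) hp, ?_⟩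
    simpa [hL] using hl

/-- To a slash edge that does not cut a lozenge of the tiling, a path of lozenges of the tiling
leads down from the upper boundary. -/
theorem exists_path_up {k : ℕ} {T : Set Lozenge} (hT : IsLozengeTiling k T) {Q : Point2}
    (h0 : 0 ≤ level Q) (hk : level Q ≤ k)
    (hQ : ∀ L ∈ T, L.rightPt + (1, 0) = Q → L.normal ≠ .y) :
    ∃ (i : ℤ) (l : List Lozenge), SlashPath (i, -i) l Q ∧ ∀ L ∈ l, L ∈ T := by
  obtain ⟨d, hd⟩ : ∃ d : ℕ, level Q = d := ⟨(level Q).toNat, by omega⟩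
  induction d using Nat.strong_induction_on generalizing Q with
  | _ d ih =>
    obtain ⟨p, q⟩ := Q
    rcases h0.eq_or_lt with h0 | h0
    · obtain rfl : q = -p := by simp [level] at h0; omega
      exact ⟨p, [], .nil _, by simp⟩
    have h5 : level (p - 1, q) = level (p, q) - 1 := by simp [level]; ring
    obtain ⟨L, ⟨hL, hLQ⟩, -⟩ := ((isLozengeTiling_iff k T).1 hT).2.2 (p - 1, q) (by omega)
      (by omega)
    have h6 : L.rightPt + (1, 0) = (p, q) := by simp [hLQ]
    have hy := hQ L hL h6
    have h1 := level_leftPt_le hy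
    have h2 := ((isLozengeTiling_iff k T).1 hT).1 L hL
    rw [hLQ] at h1
    have h3 := h2.1
    obtain ⟨i, l, hp, hl⟩ := ih (level L.leftPt).toNat (by omega)
      (Q := L.leftPt) (by omega) (by omega)
      (fun L' hL' he hy' => hy (by
        rw [← leftPt_of_normal_eq_y hy'] at he
        rwa [← eq_of_leftPt_eq hT hL' hL he])) (by omega)
    refine ⟨i, l ++ [L],
      hp.append (.cons ((slashStep_iff _ _ _).2 ⟨hy, rfl, h6⟩) (.nil _)), fun L' hL' => ?_⟩
    rcases List.mem_append.1 hL' with h | h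
    · exact hl L' h
    · rwa [List.mem_singleton.1 h]

theorem exists_lozengePath {k : ℕ} {T : Set Lozenge} (hT : IsLozengeTiling k T) (i : ℤ) :
    ∃ l, IsLozengePath k i l ∧ ∀ L ∈ l, L ∈ T := by
  obtain ⟨l, R, hR, hp, hl⟩ := exists_path_down hT (level_diag i).ge
    ((level_diag i).trans_le (Int.natCast_nonneg k)) (fun L hL he hy => by
      have h1 := (((isLozengeTiling_iff k T).1 hT).1 L hL).2.2.1
      rw [leftPt_of_normal_eq_y hy] at he
      have h2 := level_add_one L.rightPt
      rw [he, level_diag] at h2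
      omega)
  exact ⟨l, (isLozengePath_iff k i l).2 ⟨R, hR, hp⟩, hl⟩

theorem lozengePath_unique {k : ℕ} {T : Set Lozenge} (hT : IsLozengeTiling k T) {i : ℤ}
    {l l' : List Lozenge} (h : IsLozengePath k i l) (h' : IsLozengePath k i l')
    (hl : ∀ L ∈ l, L ∈ T) (hl' : ∀ L ∈ l', L ∈ T) : l = l' := by
  obtain ⟨⟨R, hR, hp⟩, -⟩ := h
  obtain ⟨⟨R', hR', hp'⟩, -⟩ := h'
  exact hp.unique hT hp' hl hl' (hR.trans hR'.symm)

/-- Each lozenge of a tiling whose normal is not `y` lies on one of the paths of the tiling. -/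
theorem exists_lozengePath_mem {k : ℕ} {T : Set Lozenge} (hT : IsLozengeTiling k T) {L : Lozenge}
    (hL : L ∈ T) (hy : L.normal ≠ .y) :
    ∃ i l, IsLozengePath k i l ∧ (∀ L ∈ l, L ∈ T) ∧ L ∈ l := by
  have hs := ((isLozengeTiling_iff k T).1 hT).1 L hL
  obtain ⟨i, l, hp, hl⟩ := exists_path_up hT (Q := L.leftPt) hs.1 hs.2.1.le
    (fun L' hL' he hy' => hy (by
      rw [← leftPt_of_normal_eq_y hy'] at he
      rwa [← eq_of_leftPt_eq hT hL' hL he]))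
  have h1 := hs.2.2.1
  have h2 := hs.2.2.2
  have h3 := level_add_one L.rightPt
  obtain ⟨l', R, hR, hp', hl'⟩ := exists_path_down hT (Q := L.rightPt + (1, 0)) (by omega)
    (by omega) (fun L' hL' he hy' => hy (by
        rw [leftPt_of_normal_eq_y hy'] at he
        rwa [← eq_of_rightPt_eq hT hL' hL (add_right_cancel he)]))
  refine ⟨i, l ++ L :: l', (isLozengePath_iff _ _ _).2 ⟨R, hR, hp.append
    (.cons ((slashStep_iff _ _ _).2 ⟨hy, rfl, rfl⟩) hp')⟩, fun L' hL' => ?_, by simp⟩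
  rcases List.mem_append.1 hL' with h | h
  · exact hl L' h
  · rcases List.mem_cons.1 h with rfl | h
    · exact hL
    · exact hl' L' h

/-! ### The height function of a tiling -/

open Classical in
/-- The indicator function of a set of lozenges. -/
noncomputable def ind (T : Set Lozenge) (L : Lozenge) : ℤ := if L ∈ T then 1 else 0

theorem ind_of_mem {T : Set Lozenge} {L : Lozenge} (h : L ∈ T) : ind T L = 1 := if_pos h

theorem ind_of_notMem {T : Set Lozenge} {L : Lozenge} (h : L ∉ T) : ind T L = 0 := if_neg h

/-- The height function of a tiling: walking from the upper boundary of the strip to `P` along the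
lattice line of direction `(1, 0)`, one descends by one unit whenever one crosses a lozenge with
normal `x`, from its one obtuse vertex to the other. -/
noncomputable def height (T : Set Lozenge) (P : Point2) : ℤ :=
  -∑ t ∈ Finset.range (level P).toNat, ind T ⟨(-P.2 + t + 1, P.2), .x⟩

theorem height_of_level_eq_zero (T : Set Lozenge) {P : Point2} (h : level P = 0) :
    height T P = 0 := by
  simp [height, h]

theorem height_add_x (T : Set Lozenge) (p q : ℤ) (h : 0 ≤ level (p, q)) :
    height T (p + 1, q) = height T (p, q) - ind T ⟨(p + 1, q), .x⟩ := by
  have h1 : (level (p + 1, q)).toNat = (level (p, q)).toNat + 1 := by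
    simp only [level] at h ⊢
    omega
  have h2 : -q + ((level (p, q)).toNat : ℤ) = p := by
    simp only [level] at h ⊢
    omega
  simp only [height, h1, Finset.sum_range_succ, h2]
  ring

section Tiling

variable {k : ℕ} {T : Set Lozenge} (hT : IsLozengeTiling k T)
include hT

theorem inStrip_of_mem {L : Lozenge} (h : L ∈ T) : L.InStrip k :=
  ((isLozengeTiling_iff k T).1 hT).1 L h

theorem notMem_of_leftPt_eq {L L' : Lozenge} (hL : L ∈ T) (h : L'.leftPt = L.leftPt)
    (hne : L' ≠ L) : L' ∉ T := fun hL' => hne (eq_of_leftPt_eq hT hL' hL h)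

theorem notMem_of_rightPt_eq {L L' : Lozenge} (hL : L ∈ T) (h : L'.rightPt = L.rightPt)
    (hne : L' ≠ L) : L' ∉ T := fun hL' => hne (eq_of_rightPt_eq hT hL' hL h)

/-- A left triangle is contained in exactly one lozenge. -/
theorem ind_left (p q : ℤ) (h0 : 0 ≤ level (p, q)) (hk : level (p, q) < k) :
    ind T ⟨(p, q), .z⟩ + ind T ⟨(p + 1, q + 1), .x⟩ + ind T ⟨(p, q + 1), .y⟩ = 1 := by
  obtain ⟨L, ⟨hL, hLQ⟩, -⟩ := ((isLozengeTiling_iff k T).1 hT).2.1 _ h0 hk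
  have key : ∀ L' : Lozenge, L'.leftPt = (p, q) → L' ≠ L → ind T L' = 0 := fun L' h hne =>
    ind_of_notMem (notMem_of_leftPt_eq hT hL (h.trans hLQ.symm) hne)
  rcases (leftPt_eq_iff L p q).1 hLQ with rfl | rfl | rfl
  · rw [ind_of_mem hL, key _ (by simp [Lozenge.leftPt]) (by simp),
      key _ (by simp [Lozenge.leftPt]) (by simp)]
    norm_num
  · rw [ind_of_mem hL, key ⟨(p, q), .z⟩ (by simp [Lozenge.leftPt]) (by simp),
      key ⟨(p, q + 1), .y⟩ (by simp [Lozenge.leftPt]) (by simp)]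
    norm_num
  · rw [ind_of_mem hL, key ⟨(p, q), .z⟩ (by simp [Lozenge.leftPt]) (by simp),
      key ⟨(p + 1, q + 1), .x⟩ (by simp [Lozenge.leftPt]) (by simp)]
    norm_num

/-- A right triangle is contained in exactly one lozenge. -/
theorem ind_right (p q : ℤ) (h0 : 0 ≤ level (p, q)) (hk : level (p, q) < k) :
    ind T ⟨(p, q), .z⟩ + ind T ⟨(p + 1, q), .x⟩ + ind T ⟨(p + 1, q + 1), .y⟩ = 1 := by
  obtain ⟨L, ⟨hL, hLQ⟩, -⟩ := ((isLozengeTiling_iff k T).1 hT).2.2 _ h0 hk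
  have key : ∀ L' : Lozenge, L'.rightPt = (p, q) → L' ≠ L → ind T L' = 0 := fun L' h hne =>
    ind_of_notMem (notMem_of_rightPt_eq hT hL (h.trans hLQ.symm) hne)
  rcases (rightPt_eq_iff L p q).1 hLQ with rfl | rfl | rfl
  · rw [ind_of_mem hL, key _ (by simp [Lozenge.rightPt]) (by simp),
      key _ (by simp [Lozenge.rightPt]) (by simp)]
    norm_num
  · rw [ind_of_mem hL, key ⟨(p, q), .z⟩ (by simp [Lozenge.rightPt]) (by simp),
      key ⟨(p + 1, q + 1), .y⟩ (by simp [Lozenge.rightPt]) (by simp)]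
    norm_num
  · rw [ind_of_mem hL, key ⟨(p, q), .z⟩ (by simp [Lozenge.rightPt]) (by simp),
      key ⟨(p + 1, q), .x⟩ (by simp [Lozenge.rightPt]) (by simp)]
    norm_num

theorem ind_eq_zero_of_level {L : Lozenge}
    (h : level L.leftPt < 0 ∨ level L.rightPt < 0 ∨ k ≤ level L.leftPt ∨ k ≤ level L.rightPt) :
    ind T L = 0 := by
  refine ind_of_notMem fun hL => ?_
  obtain ⟨h1, h2, h3, h4⟩ := inStrip_of_mem hT hL
  omega

/-- The height also changes by the expected amount along lattice edges of direction `(0, 1)`: the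
sum of the changes around each unit triangle vanishes. -/
theorem height_add_y (p q : ℤ) (h0 : 0 ≤ level (p, q)) (hk : level (p, q) ≤ k) :
    height T (p, q + 1) = height T (p, q) - ind T ⟨(p, q + 1), .y⟩ := by
  obtain ⟨d, hd⟩ : ∃ d : ℕ, level (p, q) = d := ⟨(level (p, q)).toNat, by omega⟩
  induction d generalizing p with
  | zero =>
    have h1 := height_add_x T (p - 1) (q + 1) (by simp [level] at hd ⊢; omega)
    rw [sub_add_cancel, height_of_level_eq_zero T (P := (p - 1, q + 1))
      (by simp [level] at hd ⊢; omega),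
      ind_eq_zero_of_level hT (.inl (by simp [level, Lozenge.leftPt] at hd ⊢; omega))] at h1
    rw [h1, height_of_level_eq_zero T hd,
      ind_eq_zero_of_level hT (.inr (.inl (by simp [level, Lozenge.rightPt] at hd ⊢; omega)))]
  | succ d ih =>
    obtain ⟨p, rfl⟩ : ∃ p', p = p' + 1 := ⟨p - 1, by ring⟩
    have hd' : level (p, q) = d := by simp [level] at hd ⊢; omega
    have h1 := ih p (by omega) (by omega) hd'
    have h2 := height_add_x T p q (by omega)
    have h3 := height_add_x T p (q + 1) (by simp [level] at hd ⊢; omega)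
    have h4 := ind_left hT p q (by omega) (by omega)
    have h5 := ind_right hT p q (by omega) (by omega)
    omega

/-- Along a vertical edge, the height changes by one unit unless the edge is the short diagonal of a
horizontal lozenge. -/
theorem height_add_xy (p q : ℤ) (h0 : 0 ≤ level (p, q)) (hk : level (p, q) < k) :
    height T (p + 1, q + 1) = height T (p, q) - 1 + ind T ⟨(p, q), .z⟩ := by
  have h1 := height_add_x T p (q + 1) (by simp [level] at h0 ⊢; omega)
  have h2 := height_add_y hT p q h0 hk.le
  have h4 := ind_left hT p q h0 hk
  omega

theorem height_of_z_mem {a b : ℤ} (h : (⟨(a, b), .z⟩ : Lozenge) ∈ T) :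
    height T (a + 1, b) = height T (a, b) ∧ height T (a, b + 1) = height T (a, b) ∧
      height T (a + 1, b + 1) = height T (a, b) := by
  obtain ⟨h1, h2, -, -⟩ := inStrip_of_mem hT h
  simp only [Lozenge.leftPt] at h1 h2
  have hx := height_add_x T a b h1
  have hy := height_add_y hT a b h1 h2.le
  have hz := height_add_xy hT a b h1 h2
  rw [ind_of_notMem (notMem_of_rightPt_eq hT h (by simp [Lozenge.rightPt]) (by simp))] at hx
  rw [ind_of_notMem (notMem_of_leftPt_eq hT h (by simp [Lozenge.leftPt]) (by simp))] at hy
  rw [ind_of_mem h] at hz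
  omega

theorem height_of_x_mem {a b : ℤ} (h : (⟨(a, b), .x⟩ : Lozenge) ∈ T) :
    height T (a, b + 1) = height T (a, b) ∧ height T (a - 1, b - 1) = height T (a, b) + 1 ∧
      height T (a - 1, b) = height T (a, b) + 1 := by
  obtain ⟨h1, h2, h3, h4⟩ := inStrip_of_mem hT h
  simp only [Lozenge.leftPt, Lozenge.rightPt, level] at h1 h2 h3 h4
  have hx := height_add_x T (a - 1) b (by simp [level]; omega)
  have hy := height_add_y hT (a - 1) (b - 1) (by simp [level]; omega) (by simp [level]; omega)
  have hy' := height_add_y hT a b (by simp [level]; omega) (by simp [level]; omega)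
  rw [sub_add_cancel, ind_of_mem h] at hx
  rw [sub_add_cancel,
    ind_of_notMem (notMem_of_leftPt_eq hT h (by simp [Lozenge.leftPt]) (by simp))] at hy
  rw [ind_of_notMem (notMem_of_rightPt_eq hT h (by simp [Lozenge.rightPt]) (by simp))] at hy'
  omega

theorem height_of_y_mem {a b : ℤ} (h : (⟨(a, b), .y⟩ : Lozenge) ∈ T) :
    height T (a + 1, b) = height T (a, b) ∧ height T (a - 1, b - 1) = height T (a, b) + 1 ∧
      height T (a, b - 1) = height T (a, b) + 1 := by
  obtain ⟨h1, h2, h3, h4⟩ := inStrip_of_mem hT h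
  simp only [Lozenge.leftPt, Lozenge.rightPt, level] at h1 h2 h3 h4
  have hy := height_add_y hT a (b - 1) (by simp [level]; omega) (by simp [level]; omega)
  have hx := height_add_x T (a - 1) (b - 1) (by simp [level]; omega)
  have hx' := height_add_x T a b (by simp [level]; omega)
  rw [sub_add_cancel, ind_of_mem h] at hy
  rw [sub_add_cancel,
    ind_of_notMem (notMem_of_rightPt_eq hT h (by simp [Lozenge.rightPt]) (by simp))] at hx
  rw [ind_of_notMem (notMem_of_leftPt_eq hT h (by simp [Lozenge.leftPt]) (by simp))] at hx'
  omega

theorem height_upper {P : Point2} (h : P ∈ zigzag 0) : height T P = 0 := by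
  obtain ⟨p, q⟩ := P
  rcases h with h | h
  · exact height_of_level_eq_zero T h
  · have h0 : level (p - 1, q) = 0 := by simp [level] at h ⊢; omega
    have h1 := height_add_x T (p - 1) q (by omega)
    rw [sub_add_cancel, height_of_level_eq_zero T h0,
      ind_eq_zero_of_level hT (.inl (by simp [level, Lozenge.leftPt] at h ⊢; omega))] at h1
    exact h1

theorem height_lower_x (p q : ℤ) (h : level (p, q) = k) :
    height T (p + 1, q) = height T (p, q) := by
  have h1 := height_add_x T p q (by omega)
  rw [ind_eq_zero_of_level hT (.inr (.inr (.inr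
    (by simp [level, Lozenge.rightPt] at h ⊢; omega))))] at h1
  simpa using h1

theorem height_lower_y (p q : ℤ) (h : level (p, q) = k) :
    height T (p, q + 1) = height T (p, q) := by
  have h1 := height_add_y hT p q (by omega) (by omega)
  rw [ind_eq_zero_of_level hT (.inr (.inr (.inl
    (by simp [level, Lozenge.leftPt] at h ⊢; omega))))] at h1
  simpa using h1

/-- The height is constant on the lower boundary. -/
theorem height_lower {P : Point2} (h : P ∈ zigzag k) : height T P = height T (k, 0) := by
  have key : ∀ q : ℤ, height T (k - q, q) = height T (k, 0) := by
    have step : ∀ q : ℤ, height T (k - (q + 1), q + 1) = height T (k - q, q) := fun q => by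
      have h1 := height_lower_x hT (k - (q + 1)) (q + 1) (by simp [level])
      have h2 := height_lower_y hT (k - q) q (by simp [level])
      rw [← h2, ← h1]
      congr 2
      ring
    intro q
    induction q using Int.induction_on with
    | zero => simp
    | succ q ih => rw [step, ih]
    | pred q ih => rw [← ih, ← step, sub_add_cancel]
  obtain ⟨p, q⟩ := P
  rcases h with h | h
  · obtain rfl : p = k - q := by simp [level] at h; omega
    exact key q
  · obtain rfl : p = k - q + 1 := by simp [level] at h; omega
    rw [height_lower_x hT _ _ (by simp [level]), key]

/-- Along a path of lozenges of a tiling the height decreases with each non-horizontal lozenge, and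
the surface above the path remains between the same two planes `y = j` and `y = j + 1`. -/
theorem height_path {Q R : Point2} {l : List Lozenge} (h : SlashPath Q l R)
    (hl : ∀ L ∈ l, L ∈ T) :
    height T R = height T Q - (l.length - l.countP Lozenge.isHorizontal) ∧
      (∀ L ∈ l, L.normal = .z → L.corner.2 + height T L.corner = Q.2 + height T Q) := by
  induction h with
  | nil => simp
  | @cons L₀ l Q Q₁ R hs hp ih =>
    have ih := ih fun L hL => hl L (List.mem_cons_of_mem _ hL)
    have h0 := hl L₀ List.mem_cons_self
    obtain ⟨p, q⟩ := Q
    cases hs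
    · have h1 := height_of_z_mem hT h0
      refine ⟨?_, fun L hL hz => ?_⟩
      · rw [ih.1, show ((p, q) : Point2) + (1, 0) = (p + 1, q) by simp, h1.1,
          List.countP_cons_of_pos rfl]
        simp
      · rcases List.mem_cons.1 hL with rfl | hL
        · rfl
        · rw [ih.2 L hL hz, show ((p, q) : Point2) + (1, 0) = (p + 1, q) by simp, h1.1]
    · rw [show ((p, q) : Point2) + (1, 1) = (p + 1, q + 1) by simp] at *
      have h1 := height_of_x_mem hT h0
      simp only [add_sub_cancel_right] at h1
      refine ⟨?_, fun L hL hz => ?_⟩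
      · rw [ih.1, h1.2.1]
        simp [Lozenge.isHorizontal]
        ring
      · rcases List.mem_cons.1 hL with rfl | hL
        · simp at hz
        · rw [ih.2 L hL hz, h1.2.1]
          simp only
          ring

/-- Each path of a tiling descends from the height of the upper to that of the lower boundary, so
that all paths have the same number of horizontal lozenges. -/
theorem countP_path {i : ℤ} {l : List Lozenge} (h : IsLozengePath k i l) (hl : ∀ L ∈ l, L ∈ T) :
    (l.countP Lozenge.isHorizontal : ℤ) = k + 2 * height T (k, 0) := by
  obtain ⟨⟨R, hR, hp⟩, -⟩ := h
  have h1 := (height_path hT hp hl).1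
  rw [height_of_level_eq_zero T (level_diag i), height_lower hT (.inl hR)] at h1
  rw [hp.end_eq] at hR
  simp only [level, Prod.fst_add, Prod.snd_add] at hR
  omega

/-- The paths of a tiling have `s` horizontal lozenges if and only if the two boundaries have the
appropriate difference of heights. -/
theorem forall_path_iff (s : ℕ) :
    (∀ (i : ℤ) (l : List Lozenge), IsLozengePath k i l → (∀ L ∈ l, L ∈ T) →
      l.countP Lozenge.isHorizontal = s) ↔ (s : ℤ) = k + 2 * height T (k, 0) := by
  constructor
  · intro h
    obtain ⟨l, hp, hl⟩ := exists_lozengePath hT 0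
    rw [← countP_path hT hp hl, h 0 l hp hl]
  · intro h i l hp hl
    have := countP_path hT hp hl
    omega

end Tiling

theorem mem_periodicTilings_iff (m k s : ℕ) (T : Set Lozenge) :
    T ∈ periodicTilings m k s ↔ IsLozengeTiling k T ∧ (s : ℤ) = k + 2 * height T (k, 0) ∧
      ∀ L : Lozenge, L ∈ T ↔ L.translate ((m : ℤ), -(m : ℤ)) ∈ T := by
  refine and_congr_right fun hT => and_congr_left' (forall_path_iff hT s)

theorem height_translate {m : ℕ} {T : Set Lozenge}
    (h : ∀ L : Lozenge, L ∈ T ↔ L.translate ((m : ℤ), -(m : ℤ)) ∈ T) (p q : ℤ) :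
    height T (p + m, q - m) = height T (p, q) := by
  have h1 : level (p + m, q - m) = level (p, q) := by simp [level]
  simp only [height, h1, ind]
  congr 1
  refine Finset.sum_congr rfl fun t _ => ?_
  rw [h ⟨(-q + t + 1, q), .x⟩]
  congr 4
  ring

/-! ### Cliffs and tilings -/

/-- The projection of a face. -/
def Face.toLozenge (f : Face) : Lozenge := ⟨proj f.corner, f.normal⟩

theorem proj_add (v w : Point3) : proj (v + w) = proj v + proj w := by
  simp [proj, Prod.ext_iff]
  constructor <;> ring

theorem image_proj_vertices (f : Face) : f.vertices.image proj = f.toLozenge.vertices := by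
  simp [Face.vertices, Lozenge.vertices, Face.toLozenge, Finset.image_insert, proj_add]

/-- The lattice point of height `h` above `P`. -/
def lift (P : Point2) (h : ℤ) : Point3 := (P.1 + h, P.2 + h, h)

theorem proj_lift (P : Point2) (h : ℤ) : proj (lift P h) = P := by
  simp [proj, lift]

theorem lift_proj (v : Point3) : lift (proj v) v.2.2 = v := by
  simp [proj, lift]

theorem lift_mem_zigzag3 (P : Point2) (a h : ℤ) :
    lift P h ∈ zigzag3 a h ↔ P ∈ zigzag (a - 2 * h) := by
  change ((P.1 + h + (P.2 + h) = a ∨ P.1 + h + (P.2 + h) = a + 1) ∧ h = h) ↔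
    (P.1 + P.2 = a - 2 * h ∨ P.1 + P.2 = a - 2 * h + 1)
  omega

theorem proj_image_zigzag3 (a h : ℤ) : proj '' zigzag3 a h = zigzag (a - 2 * h) := by
  ext P
  constructor
  · rintro ⟨v, hv, rfl⟩
    rw [← lift_mem_zigzag3, ← hv.2, lift_proj, hv.2]
    exact hv
  · intro hP
    exact ⟨lift P h, (lift_mem_zigzag3 P a h).2 hP, proj_lift P h⟩

theorem zigzag_injective : Function.Injective zigzag := by
  intro a b h
  have h1 : ((a, 0) : Point2) ∈ zigzag b := h ▸ (by simp [zigzag, level])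
  have h2 : ((b, 0) : Point2) ∈ zigzag a := h ▸ (by simp [zigzag, level])
  simp only [zigzag, level, Set.mem_ofPred_eq] at h1 h2
  omega

/-- The stepped surface above a tiling: the faces that project to the lozenges of the tiling, at the
heights that the height function prescribes. -/
def surface (T : Set Lozenge) : Set Face :=
  {f | f.toLozenge ∈ T ∧ f.corner.2.2 = height T (proj f.corner)}

theorem image_surface (T : Set Lozenge) : Face.toLozenge '' surface T = T := by
  ext L
  constructor
  · rintro ⟨f, hf, rfl⟩
    exact hf.1
  · intro hL
    have h : (⟨lift L.corner (height T L.corner), L.normal⟩ : Face).toLozenge = L := by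
      simp [Face.toLozenge, proj_lift]
    exact ⟨⟨lift L.corner (height T L.corner), L.normal⟩,
      ⟨by rwa [h], by simp only [proj_lift]; rfl⟩, h⟩

theorem surface_injective : Function.Injective surface := fun T T' h => by
  rw [← image_surface T, h, image_surface]

theorem toLozenge_injOn_surface (T : Set Lozenge) : Set.InjOn Face.toLozenge (surface T) := by
  intro f hf g hg h
  have h1 : proj f.corner = proj g.corner := congrArg Lozenge.corner h
  have h2 : f.normal = g.normal := congrArg Lozenge.normal h
  refine Face.ext ?_ h2
  rw [← lift_proj f.corner, ← lift_proj g.corner, hf.2, hg.2, h1]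

/-- All vertices of the surface above a tiling have the height given by the height function. -/
theorem height_of_mem_surface {k : ℕ} {T : Set Lozenge} (hT : IsLozengeTiling k T) {f : Face}
    (hf : f ∈ surface T) {v : Point3} (hv : v ∈ f.vertices) : v.2.2 = height T (proj v) := by
  obtain ⟨c, ν⟩ := f
  obtain ⟨h1, h2⟩ := hf
  obtain ⟨P, h, rfl⟩ : ∃ P h, c = lift P h := ⟨_, _, (lift_proj c).symm⟩
  obtain ⟨p, q⟩ := P
  simp only [Face.toLozenge, proj_lift] at h1 h2
  change h = _ at h2
  subst h2
  cases ν
  · have := height_of_x_mem hT h1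
    simp only [Face.vertices, Axis.others, Axis.vec, Finset.mem_insert,
      Finset.mem_singleton] at hv
    rcases hv with rfl | rfl | rfl | rfl <;> simp only [proj_add, proj_lift] <;>
      simp [lift, proj, ← sub_eq_add_neg, this]
  · have := height_of_y_mem hT h1
    simp only [Face.vertices, Axis.others, Axis.vec, Finset.mem_insert,
      Finset.mem_singleton] at hv
    rcases hv with rfl | rfl | rfl | rfl <;> simp only [proj_add, proj_lift] <;>
      simp [lift, proj, ← sub_eq_add_neg, this]
  · have := height_of_z_mem hT h1
    simp only [Face.vertices, Axis.others, Axis.vec, Finset.mem_insert,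
      Finset.mem_singleton] at hv
    rcases hv with rfl | rfl | rfl | rfl <;> simp only [proj_add, proj_lift] <;>
      simp [lift, proj, this]

theorem isCliff_surface {k n : ℕ} {T : Set Lozenge} (hT : IsLozengeTiling k T)
    (hn : height T (k, 0) = -n) : IsCliff n (surface T) := by
  refine ⟨k, k - 2 * n, by simp [proj_image_zigzag3], ?_, ?_, ?_, ?_⟩
  · rw [proj_image_zigzag3]
    congr 1
    ring
  · intro f hf v hv
    refine hT.1 _ hf.1 _ ?_
    rw [← image_proj_vertices]
    exact Finset.mem_image_of_mem _ hv
  · intro t ht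
    obtain ⟨L, ⟨hL, htL⟩, hu⟩ := hT.2 t ht
    rw [← image_surface T] at hL
    obtain ⟨f, hf, rfl⟩ := hL
    refine ⟨f, ⟨hf, by rwa [image_proj_vertices]⟩, fun g hg => ?_⟩
    refine toLozenge_injOn_surface T hg.1 hf (hu _ ⟨hg.1.1, ?_⟩)
    rw [← image_proj_vertices]
    exact hg.2
  · have key : ∀ v ∈ {v | ∃ f ∈ surface T, v ∈ f.vertices} ∪ zigzag3 0 0 ∪
        zigzag3 (k - 2 * n) (-n), v.2.2 = height T (proj v) := by
      rintro v ((⟨f, hf, hv⟩ | hv) | hv)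
      · exact height_of_mem_surface hT hf hv
      · have h1 : proj v ∈ zigzag 0 := by
          have := Set.mem_image_of_mem proj hv
          rwa [proj_image_zigzag3] at this
        rw [height_upper hT h1, hv.2]
      · have h1 : proj v ∈ zigzag k := by
          have := Set.mem_image_of_mem proj hv
          rw [proj_image_zigzag3] at this
          convert this using 2
          ring
        rw [height_lower hT h1, hv.2, hn]
    intro v hv w hw h
    rw [← lift_proj v, ← lift_proj w, key v hv, key w hw, h]

theorem IsCliff.exists_tiling {n : ℕ} {F : Set Face} (hF : IsCliff n F) :
    ∃ (k : ℕ) (T : Set Lozenge), IsLozengeTiling k T ∧ height T (k, 0) = -n ∧ F = surface T := by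
  obtain ⟨k, a, -, h2, h3, h4, h5⟩ := hF
  have ha : a - 2 * (-n) = k := zigzag_injective (by rw [← proj_image_zigzag3, h2])
  set S := {v | ∃ f ∈ F, v ∈ f.vertices} ∪ zigzag3 0 0 ∪ zigzag3 a (-n) with hS
  have hT : IsLozengeTiling k (Face.toLozenge '' F) := by
    constructor
    · rintro _ ⟨f, hf, rfl⟩ P hP
      rw [← image_proj_vertices] at hP
      obtain ⟨v, hv, rfl⟩ := Finset.mem_image.1 hP
      exact h3 f hf v hv
    · intro t ht
      obtain ⟨f, ⟨hf, htf⟩, hu⟩ := h4 t ht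
      refine ⟨f.toLozenge, ⟨⟨f, hf, rfl⟩, by rwa [← image_proj_vertices]⟩, ?_⟩
      rintro _ ⟨⟨g, hg, rfl⟩, htg⟩
      rw [hu g ⟨hg, by rwa [image_proj_vertices]⟩]
  set T := Face.toLozenge '' F with hTdef
  have hface : ∀ f ∈ F, ∀ v ∈ f.vertices, v ∈ S := fun f hf v hv => .inl (.inl ⟨f, hf, hv⟩)
  have hlow : ∀ P ∈ zigzag k, lift P (-n) ∈ S := fun P hP =>
    .inr ((lift_mem_zigzag3 P a (-n)).2 (ha ▸ hP))
  have huniq : ∀ {P : Point2} {h h' : ℤ}, lift P h ∈ S → lift P h' ∈ S → h = h' :=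
    fun {P h h'} hv hv' => congrArg (fun v : Point3 => v.2.2)
      (h5 hv hv' ((proj_lift P h).trans (proj_lift P h').symm))
  -- Above each point of the strip there is a point of the surface at the height prescribed by the
  -- height function: one walks from the upper boundary along lattice lines of direction `(1, 0)`.
  have key : ∀ (d : ℕ) (p q : ℤ), level (p, q) = d → d ≤ k + 1 →
      lift (p, q) (height T (p, q)) ∈ S := by
    intro d
    induction d with
    | zero =>
      intro p q hd _
      rw [height_of_level_eq_zero T hd]
      exact .inl (.inr ((lift_mem_zigzag3 _ 0 0).2 (.inl (by simpa using hd))))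
    | succ d ih =>
      intro p q hd hk
      obtain ⟨p, rfl⟩ : ∃ p', p = p' + 1 := ⟨p - 1, by ring⟩
      have hd' : level (p, q) = d := by simp [level] at hd ⊢; omega
      have hmem₀ := ih p q hd' (by omega)
      rcases (show d < k ∨ d = k by omega) with hdk | rfl
      · obtain ⟨_, ⟨⟨f, hf, rfl⟩, hfr⟩, -⟩ := ((isLozengeTiling_iff k T).1 hT).2.2 (p, q)
          (by omega) (by omega)
        have hfT : f.toLozenge ∈ T := ⟨f, hf, rfl⟩
        have hmem := hface f hf
        obtain ⟨c, ν⟩ := f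
        obtain ⟨P, h, rfl⟩ : ∃ P h, c = lift P h := ⟨_, _, (lift_proj c).symm⟩
        simp only [Face.toLozenge, proj_lift] at hfr hfT
        rcases (rightPt_eq_iff _ p q).1 hfr with he | he | he
        · obtain ⟨rfl, rfl⟩ := Lozenge.mk.inj he
          rw [(height_of_z_mem hT hfT).1,
            ← huniq (hmem (lift (p, q) h) (by simp [Face.vertices]))
            hmem₀]
          have := hmem (lift (p, q) h + (1, 0, 0)) (by simp [Face.vertices, Axis.others, Axis.vec])
          convert this using 1
          simp [lift, add_right_comm]
        · obtain ⟨rfl, rfl⟩ := Lozenge.mk.inj he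
          have hh := (height_of_x_mem hT hfT).2.2
          rw [add_sub_cancel_right] at hh
          have h1 := hmem (lift (p + 1, q) h + (0, 1, 0) + (0, 0, 1))
            (by simp [Face.vertices, Axis.others, Axis.vec])
          have h2 : lift (p + 1, q) h + (0, 1, 0) + (0, 0, 1) = lift (p, q) (h + 1) := by
            simp [lift, Prod.ext_iff]
            constructor <;> ring
          rw [h2] at h1
          have h3 := huniq h1 hmem₀
          rw [show height T (p + 1, q) = h by omega]
          exact hmem _ (by simp [Face.vertices])
        · obtain ⟨rfl, rfl⟩ := Lozenge.mk.inj he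
          have hh := height_of_y_mem hT hfT
          simp only [add_sub_cancel_right] at hh
          have h1 := hmem (lift (p + 1, q + 1) h + (0, 0, 1))
            (by simp [Face.vertices, Axis.others, Axis.vec])
          have h2 : lift (p + 1, q + 1) h + (0, 0, 1) = lift (p, q) (h + 1) := by
            simp [lift, Prod.ext_iff]
            constructor <;> ring
          rw [h2] at h1
          have h3 := huniq h1 hmem₀
          have h4 := hmem (lift (p + 1, q + 1) h + (1, 0, 0) + (0, 0, 1))
            (by simp [Face.vertices, Axis.others, Axis.vec])
          have h5 : lift (p + 1, q + 1) h + (1, 0, 0) + (0, 0, 1) = lift (p + 1, q) (h + 1) := by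
            simp [lift, Prod.ext_iff]
            constructor <;> ring
          rw [h5] at h4
          rwa [show height T (p + 1, q) = h + 1 by omega]
      · rw [height_lower_x hT p q hd', huniq hmem₀ (hlow _ (.inl hd'))]
        exact hlow _ (.inr (by simp [level] at hd ⊢; omega))
  have key' : ∀ v ∈ S, proj v ∈ strip k → v.2.2 = height T (proj v) := by
    intro v hv hs
    obtain ⟨h0, hk⟩ := hs
    refine huniq (P := proj v) (by rwa [lift_proj]) ?_
    exact key (level (proj v)).toNat (proj v).1 (proj v).2 (by simpa using h0) (by omega)
  refine ⟨k, T, hT, ?_, ?_⟩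
  · have h := key' (lift (k, 0) (-n)) (hlow _ (.inl (by simp [level])))
      (by simp [proj_lift, strip, level])
    rw [proj_lift] at h
    exact h.symm
  · have hc : ∀ f ∈ F, f.corner.2.2 = height T (proj f.corner) := fun f hf =>
      key' _ (hface f hf _ (by simp [Face.vertices])) (h3 f hf _ (by simp [Face.vertices]))
    ext f
    refine ⟨fun hf => ⟨⟨f, hf, rfl⟩, hc f hf⟩, ?_⟩
    rintro ⟨⟨g, hg, hgf⟩, hf⟩
    have h1 : proj g.corner = proj f.corner := congrArg Lozenge.corner hgf
    have h2 : g.normal = f.normal := congrArg Lozenge.normal hgf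
    have : g = f := by
      refine Face.ext ?_ h2
      rw [← lift_proj f.corner, ← lift_proj g.corner, hf, hc g hg, h1]
    exact this ▸ hg

/-- The horizontal faces between the planes `y = j` and `y = j + 1` lie above the horizontal
lozenges of the path that starts at the slash edge from `(-j, j)` to `(-j, j + 1)`. -/
theorem encard_slice {k : ℕ} {T : Set Lozenge} (hT : IsLozengeTiling k T) (j : ℤ) :
    ∃ r : ℕ, {f | f ∈ surface T ∧ f.normal = .z ∧ f.corner.2.1 = j}.encard = r ∧
      (r : ℤ) = k + 2 * height T (k, 0) := by
  obtain ⟨l, hp, hl⟩ := exists_lozengePath hT (-j)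
  refine ⟨_, ?_, countP_path hT hp hl⟩
  classical
  have hinj : Set.InjOn Face.toLozenge {f | f ∈ surface T ∧ f.normal = .z ∧ f.corner.2.1 = j} :=
    (toLozenge_injOn_surface T).mono fun f hf => hf.1
  rw [← hinj.encard_image]
  have himg : Face.toLozenge '' {f | f ∈ surface T ∧ f.normal = .z ∧ f.corner.2.1 = j} =
      ((l.filter Lozenge.isHorizontal).toFinset : Set Lozenge) := by
    ext L
    simp only [Set.mem_image, Set.mem_ofPred_eq, List.coe_toFinset, List.mem_filter]
    have hz : L.isHorizontal = true ↔ L.normal = .z := by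
      obtain ⟨C, ν⟩ := L
      cases ν <;> simp [Lozenge.isHorizontal]
    rw [hz]
    constructor
    · rintro ⟨f, ⟨hf, hfz, hfj⟩, rfl⟩
      refine ⟨?_, hfz⟩
      obtain ⟨i, l', hp', hl', hmem⟩ := exists_lozengePath_mem hT hf.1
        (by rw [show f.toLozenge.normal = .z from hfz]; simp)
      obtain ⟨⟨R, hR, hs⟩, -⟩ := id hp'
      have h1 := (height_path hT hs hl').2 _ hmem hfz
      rw [height_of_level_eq_zero T (level_diag i)] at h1
      have h2 : f.toLozenge.corner.2 + height T f.toLozenge.corner = f.corner.2.1 := by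
        change f.corner.2.1 - f.corner.2.2 + height T (proj f.corner) = _
        rw [← hf.2]
        ring
      obtain rfl : i = -j := by simp only at h1; omega
      rwa [lozengePath_unique hT hp hp' hl hl']
    · rintro ⟨hL, hLz⟩
      obtain ⟨⟨R, hR, hs⟩, -⟩ := id hp
      have h1 := (height_path hT hs hl).2 _ hL hLz
      rw [height_of_level_eq_zero T (level_diag _)] at h1
      have hLT := hl L hL
      rw [← image_surface T] at hLT
      obtain ⟨f, hf, rfl⟩ := hLT
      refine ⟨f, ⟨hf, hLz, ?_⟩, rfl⟩
      change f.corner.2.1 - f.corner.2.2 + height T (proj f.corner) = _ at h1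
      rw [← hf.2] at h1
      simp only at h1
      omega
  obtain ⟨⟨R, hR, hs⟩, -⟩ := hp
  rw [himg, Set.encard_coe_eq_coe_finsetCard, List.toFinset_card_of_nodup (hs.nodup.filter _),
    List.countP_eq_length_filter]

theorem hasHorizontalDisplacement_surface_iff {k : ℕ} {T : Set Lozenge}
    (hT : IsLozengeTiling k T) (s : ℕ) :
    HasHorizontalDisplacement s (surface T) ↔ (s : ℤ) = k + 2 * height T (k, 0) := by
  constructor
  · intro h
    obtain ⟨r, hr, hr'⟩ := encard_slice hT 0
    rw [h 0, Nat.cast_inj] at hr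
    rw [hr, hr']
  · intro h j
    obtain ⟨r, hr, hr'⟩ := encard_slice hT j
    rw [hr, Nat.cast_inj]
    omega

theorem periodic_surface_iff (m : ℕ) (T : Set Lozenge) :
    (∀ f : Face, f ∈ surface T ↔ f.translate ((m : ℤ), -(m : ℤ), 0) ∈ surface T) ↔
      ∀ L : Lozenge, L ∈ T ↔ L.translate ((m : ℤ), -(m : ℤ)) ∈ T := by
  have htr : ∀ f : Face, (f.translate ((m : ℤ), -(m : ℤ), 0)).toLozenge =
      f.toLozenge.translate ((m : ℤ), -(m : ℤ)) := fun f => by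
    simp [Face.translate, Face.toLozenge, Lozenge.translate, proj]
    constructor <;> ring
  constructor
  · intro h L
    constructor
    · intro hL
      rw [← image_surface T] at hL
      obtain ⟨f, hf, rfl⟩ := hL
      rw [← htr]
      exact ((h f).1 hf).1
    · intro hL
      rw [← image_surface T] at hL
      obtain ⟨f, hf, hfL⟩ := hL
      obtain ⟨g, rfl⟩ : ∃ g : Face, f = g.translate ((m : ℤ), -(m : ℤ), 0) :=
        ⟨⟨f.corner - ((m : ℤ), -(m : ℤ), 0), f.normal⟩, by simp [Face.translate]⟩
      rw [htr] at hfL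
      have : g.toLozenge = L := by
        have h1 := congrArg Lozenge.corner hfL
        have h2 := congrArg Lozenge.normal hfL
        exact Lozenge.ext (add_right_cancel h1) h2
      rw [← this]
      exact ((h g).2 hf).1
  · intro h f
    have h1 : proj (f.translate ((m : ℤ), -(m : ℤ), 0)).corner =
        ((proj f.corner).1 + m, (proj f.corner).2 - m) := by
      simp [Face.translate, proj]
      constructor <;> ring
    have h2 : (f.translate ((m : ℤ), -(m : ℤ), 0)).corner.2.2 = f.corner.2.2 := by
      simp [Face.translate]
    simp only [surface, Set.mem_ofPred_eq, htr, ← h f.toLozenge, h1, h2, height_translate h]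

theorem periodicCliffs_eq (m n s : ℕ) :
    periodicCliffs m n s = surface '' periodicTilings m (2 * n + s) s := by
  ext F
  constructor
  · rintro ⟨hF, hs, hm⟩
    obtain ⟨k, T, hT, hn, rfl⟩ := hF.exists_tiling
    rw [hasHorizontalDisplacement_surface_iff hT] at hs
    rw [periodic_surface_iff] at hm
    obtain rfl : k = 2 * n + s := by omega
    exact ⟨T, (mem_periodicTilings_iff _ _ _ _).2 ⟨hT, hs, hm⟩, rfl⟩
  · rintro ⟨T, h, rfl⟩
    obtain ⟨hT, hs, hm⟩ := (mem_periodicTilings_iff _ _ _ _).1 h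
    exact ⟨isCliff_surface hT (by omega), (hasHorizontalDisplacement_surface_iff hT s).2 hs,
      (periodic_surface_iff m T).2 hm⟩

theorem nonempty_cliffs_equiv_tilings (m n s : ℕ) :
    Nonempty (periodicCliffs m n s ≃ periodicTilings m (2 * n + s) s) := by
  rw [periodicCliffs_eq]
  exact ⟨(Equiv.Set.image surface _ surface_injective).symm⟩

/-! ### Tilings and matchings of the honeycomb cylinder -/

/-- The vertex `a` of the honeycomb cylinder represents the left triangle `P`: its strand is the
vertical strip of triangles that contains the triangle, modulo the period. -/
def MarksLeft {m N : ℕ} (P : Point2) (a : HoneycombVertex m N) : Prop :=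
  a.1 = ((P.1 - P.2 - 1 : ℤ) : ZMod (2 * m)) ∧ (a.2.val : ℤ) = level P

/-- The vertex `a` of the honeycomb cylinder represents the right triangle `P`. -/
def MarksRight {m N : ℕ} (P : Point2) (a : HoneycombVertex m N) : Prop :=
  a.1 = ((P.1 - P.2 : ℤ) : ZMod (2 * m)) ∧ (a.2.val : ℤ) = level P

/-- The vertices `a` and `b` represent the left and the right triangle of the lozenge `L`. -/
def Lozenge.Joins {m N : ℕ} (L : Lozenge) (a b : HoneycombVertex m N) : Prop :=
  MarksLeft L.leftPt a ∧ MarksRight L.rightPt b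

/-- The translation by `j` periods. -/
def period (m : ℕ) (j : ℤ) : Point2 := (j * m, -(j * m))

theorem mem_iff_translate_period {m : ℕ} {T : Set Lozenge}
    (h : ∀ L : Lozenge, L ∈ T ↔ L.translate ((m : ℤ), -(m : ℤ)) ∈ T) (j : ℤ) (L : Lozenge) :
    L ∈ T ↔ L.translate (period m j) ∈ T := by
  have hadd : ∀ i : ℤ, (L.translate (period m i)).translate ((m : ℤ), -(m : ℤ)) =
      L.translate (period m (i + 1)) := fun i => by
    simp [Lozenge.translate, period, add_assoc]
    constructor <;> ring
  induction j using Int.induction_on with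
  | zero => simp [period, Lozenge.translate, show ((0, 0) : Point2) = 0 from rfl]
  | succ j ih => exact ih.trans ((h _).trans (by rw [hadd]))
  | pred j ih =>
    exact ih.trans (Iff.symm ((h (L.translate (period m (-j - 1)))).trans
      (by rw [hadd, sub_add_cancel])))

section Vertices

variable {m N : ℕ}

theorem two_mul_period_cast (j : ℤ) : ((2 * (j * m) : ℤ) : ZMod (2 * m)) = 0 := by
  rw [ZMod.intCast_zmod_eq_zero_iff_dvd]
  exact ⟨j, by push_cast; ring⟩

theorem marksLeft_add_period (P : Point2) (j : ℤ) (a : HoneycombVertex m N) :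
    MarksLeft (P + period m j) a ↔ MarksLeft P a := by
  have h1 : (P + period m j).1 - (P + period m j).2 - 1 = P.1 - P.2 - 1 + 2 * (j * m) := by
    simp [period]; ring
  have h2 : level (P + period m j) = level P := by simp [level, period]; ring
  rw [MarksLeft, MarksLeft, h1, h2, Int.cast_add, two_mul_period_cast, add_zero]

theorem marksRight_add_period (P : Point2) (j : ℤ) (a : HoneycombVertex m N) :
    MarksRight (P + period m j) a ↔ MarksRight P a := by
  have h1 : (P + period m j).1 - (P + period m j).2 = P.1 - P.2 + 2 * (j * m) := by
    simp [period]; ring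
  have h2 : level (P + period m j) = level P := by simp [level, period]; ring
  rw [MarksRight, MarksRight, h1, h2, Int.cast_add, two_mul_period_cast, add_zero]

theorem joins_translate (L : Lozenge) (j : ℤ) (a b : HoneycombVertex m N) :
    (L.translate (period m j)).Joins a b ↔ L.Joins a b := by
  rw [Lozenge.Joins, leftPt_translate, rightPt_translate, marksLeft_add_period,
    marksRight_add_period, Lozenge.Joins]

theorem eq_add_period {P P' : Point2} (h : ((P.1 - P.2 : ℤ) : ZMod (2 * m)) = (P'.1 - P'.2 : ℤ))
    (hl : level P = level P') : ∃ j, P = P' + period m j := by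
  rw [ZMod.intCast_eq_intCast_iff_dvd_sub] at h
  obtain ⟨j, hj⟩ := h
  refine ⟨-j, ?_⟩
  push_cast at hj
  simp only [level] at hl
  simp only [period, Prod.ext_iff, Prod.fst_add, Prod.snd_add]
  have : (2 : ℤ) * m * j = 2 * (j * m) := by ring
  constructor <;> linarith

theorem MarksLeft.eq_add_period {P P' : Point2} {a : HoneycombVertex m N} (h : MarksLeft P a)
    (h' : MarksLeft P' a) : ∃ j, P = P' + period m j := by
  refine Cliff.eq_add_period (m := m) ?_ (h.2.symm.trans h'.2)
  have := h.1.symm.trans h'.1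
  rw [Int.cast_sub, Int.cast_sub _ 1] at this
  exact sub_left_injective this

theorem MarksRight.eq_add_period {P P' : Point2} {a : HoneycombVertex m N} (h : MarksRight P a)
    (h' : MarksRight P' a) : ∃ j, P = P' + period m j :=
  Cliff.eq_add_period (h.1.symm.trans h'.1) (h.2.symm.trans h'.2)

theorem MarksLeft.unique {P : Point2} {a a' : HoneycombVertex m N} (h : MarksLeft P a)
    (h' : MarksLeft P a') : a = a' :=
  Prod.ext (h.1.trans h'.1.symm) (Fin.ext (by have := h.2; have := h'.2; omega))

theorem MarksRight.unique {P : Point2} {a a' : HoneycombVertex m N} (h : MarksRight P a)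
    (h' : MarksRight P a') : a = a' :=
  Prod.ext (h.1.trans h'.1.symm) (Fin.ext (by have := h.2; have := h'.2; omega))

theorem exists_marksLeft {P : Point2} (h0 : 0 ≤ level P) (hN : level P < N) :
    ∃ a : HoneycombVertex m N, MarksLeft P a :=
  ⟨(_, ⟨(level P).toNat, by omega⟩), rfl, by simpa using h0⟩

theorem exists_marksRight {P : Point2} (h0 : 0 ≤ level P) (hN : level P < N) :
    ∃ a : HoneycombVertex m N, MarksRight P a :=
  ⟨(_, ⟨(level P).toNat, by omega⟩), rfl, by simpa using h0⟩

theorem MarksLeft.level_bounds {P : Point2} {a : HoneycombVertex m N} (h : MarksLeft P a) :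
    0 ≤ level P ∧ level P < N := by
  have := h.2
  omega

theorem MarksRight.level_bounds {P : Point2} {a : HoneycombVertex m N} (h : MarksRight P a) :
    0 ≤ level P ∧ level P < N := by
  have := h.2
  omega

/-- As the number of strands is even, the parity of a strand is well defined. -/
theorem isTop_iff_odd [NeZero m] {a : HoneycombVertex m N} {z : ℤ} (h : a.1 = (z : ZMod (2 * m))) :
    IsTop a ↔ Odd (z + a.2.val) := by
  have h1 : ((a.1.val : ℕ) : ℤ) = z % ((2 * m : ℕ) : ℤ) := by rw [h, ZMod.val_intCast]
  have h2 : z % ((2 * m : ℕ) : ℤ) % 2 = z % 2 := Int.emod_emod_of_dvd _ ⟨m, by push_cast; ring⟩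
  rw [IsTop, ← Int.odd_coe_nat, Int.odd_iff, Int.odd_iff]
  push_cast
  omega

theorem MarksLeft.isTop [NeZero m] {P : Point2} {a : HoneycombVertex m N} (h : MarksLeft P a) :
    IsTop a := by
  rw [isTop_iff_odd h.1, h.2, level]
  exact ⟨P.1 - 1, by ring⟩

theorem MarksRight.not_isTop [NeZero m] {P : Point2} {a : HoneycombVertex m N}
    (h : MarksRight P a) : ¬ IsTop a := by
  rw [isTop_iff_odd h.1, h.2, level, Int.not_odd_iff_even]
  exact ⟨P.1, by ring⟩

theorem exists_left_of_isTop [NeZero m] {a : HoneycombVertex m N} (h : IsTop a) :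
    ∃ P, MarksLeft P a := by
  obtain ⟨r, hr⟩ := h
  have hr' : ((a.1.val : ℕ) : ℤ) + a.2.val = 2 * r + 1 := by exact_mod_cast hr
  refine ⟨(r + 1, a.2.val - (r + 1)), ?_, by simp [level]⟩
  rw [show ((r : ℤ) + 1 - (a.2.val - (r + 1)) - 1) = ((a.1.val : ℕ) : ℤ) by linarith]
  simp

theorem exists_right_of_not_isTop [NeZero m] {a : HoneycombVertex m N} (h : ¬ IsTop a) :
    ∃ P, MarksRight P a := by
  rw [IsTop, Nat.not_odd_iff_even] at h
  obtain ⟨r, hr⟩ := h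
  have hr' : ((a.1.val : ℕ) : ℤ) + a.2.val = r + r := by exact_mod_cast hr
  refine ⟨(r, a.2.val - r), ?_, by simp [level]⟩
  rw [show ((r : ℤ) - (a.2.val - r)) = ((a.1.val : ℕ) : ℤ) by linarith]
  simp

/-- Top vertices are only adjacent to bottom vertices. -/
theorem isTop_iff_of_adj [NeZero m] {a b : HoneycombVertex m N}
    (h : (honeycombCylinder m N).Adj a b) : IsTop a ↔ ¬ IsTop b := by
  have hz : ∀ c : HoneycombVertex m N, c.1 = ((c.1.val : ℤ) : ZMod (2 * m)) := fun c => by simp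
  have key : ∀ a b : HoneycombVertex m N, (b.1 = a.1 ∧ b.2.val = a.2.val + 1) ∨
      (IsTop a ∧ b.1 = a.1 + 1 ∧ b.2 = a.2) → (IsTop a ↔ ¬ IsTop b) := by
    rintro a b (⟨h1, h2⟩ | ⟨-, h1, h2⟩)
    · rw [isTop_iff_odd (hz a), isTop_iff_odd (h1.trans (hz a)), h2, Int.odd_iff, Int.odd_iff]
      omega
    · have h3 : b.1 = (((a.1.val : ℤ) + 1 : ℤ) : ZMod (2 * m)) := by
        rw [h1, Int.cast_add, ← hz a, Int.cast_one]
      rw [isTop_iff_odd (hz a), isTop_iff_odd h3, h2, Int.odd_iff, Int.odd_iff]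
      omega
  rw [honeycombCylinder, SimpleGraph.fromRel_adj] at h
  rcases h.2 with h | h
  · exact key a b h
  · have := key b a h
    tauto

theorem Lozenge.Joins.adj [NeZero m] {L : Lozenge} {a b : HoneycombVertex m N}
    (h : L.Joins a b) : (honeycombCylinder m N).Adj a b := by
  rw [honeycombCylinder, SimpleGraph.fromRel_adj]
  have ht := h.1.isTop
  refine ⟨fun he => h.2.not_isTop (he ▸ ht), ?_⟩
  obtain ⟨⟨h1, h2⟩, h3, h4⟩ := h
  obtain ⟨⟨p, q⟩, ν⟩ := L
  cases ν
  · left; left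
    simp only [Lozenge.leftPt, Lozenge.rightPt, level] at h1 h2 h3 h4
    refine ⟨?_, by omega⟩
    rw [h1, h3]
    congr 1
    ring
  · right; left
    simp only [Lozenge.leftPt, Lozenge.rightPt, level] at h1 h2 h3 h4
    refine ⟨?_, by omega⟩
    rw [h1, h3]
    congr 1
    ring
  · left; right
    simp only [Lozenge.leftPt, Lozenge.rightPt, level] at h1 h2 h3 h4
    refine ⟨ht, ?_, Fin.ext (by omega)⟩
    rw [h1, h3, Int.cast_sub _ 1, Int.cast_one, sub_add_cancel]

/-- Each edge of the honeycomb cylinder comes from a lozenge. -/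
theorem exists_joins_of_adj [NeZero m] {a b : HoneycombVertex m N}
    (h : (honeycombCylinder m N).Adj a b) {P : Point2} (hP : MarksLeft P a) :
    ∃ L : Lozenge, L.leftPt = P ∧ L.Joins a b := by
  obtain ⟨p, q⟩ := P
  suffices ∃ L : Lozenge, L.leftPt = (p, q) ∧ MarksRight L.rightPt b by
    obtain ⟨L, hL, hb⟩ := this
    exact ⟨L, hL, hL.symm ▸ hP, hb⟩
  have hnt : ¬ IsTop b := (isTop_iff_of_adj h).1 hP.isTop
  obtain ⟨h1, h2⟩ := hP
  simp only [level] at h1 h2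
  rw [honeycombCylinder, SimpleGraph.fromRel_adj] at h
  rcases h.2 with (⟨h3, h4⟩ | ⟨-, h3, h4⟩) | (⟨h3, h4⟩ | ⟨h3, -⟩)
  · refine ⟨⟨(p + 1, q + 1), .x⟩, by simp [Lozenge.leftPt], ?_, ?_⟩
    · rw [h3, h1]
      simp only [Lozenge.rightPt]
      congr 1
      ring
    · simp only [Lozenge.rightPt, level]
      omega
  · refine ⟨⟨(p, q), .z⟩, by simp [Lozenge.leftPt], ?_, ?_⟩
    · rw [h3, h1, Int.cast_sub _ 1, Int.cast_one, sub_add_cancel]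
      rfl
    · rw [h4]
      exact h2
  · refine ⟨⟨(p, q + 1), .y⟩, by simp [Lozenge.leftPt], ?_, ?_⟩
    · rw [← h3, h1]
      simp only [Lozenge.rightPt]
      congr 1
      ring
    · simp only [Lozenge.rightPt, level]
      omega
  · exact absurd h3 hnt

/-- A lozenge is determined by its left triangle and the vertex of its right triangle: the three
candidates for the latter have different levels. -/
theorem eq_of_marksRight {L L' : Lozenge} {b : HoneycombVertex m N}
    (h : L.leftPt = L'.leftPt) (hb : MarksRight L.rightPt b) (hb' : MarksRight L'.rightPt b) :
    L = L' := by
  have h1 := hb.2.symm.trans hb'.2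
  obtain ⟨⟨p, q⟩, ν⟩ := L
  obtain ⟨⟨p', q'⟩, ν'⟩ := L'
  cases ν <;> cases ν' <;> simp [Lozenge.leftPt, Lozenge.rightPt, level] at h h1 ⊢ <;> omega

theorem eq_of_marksLeft {L L' : Lozenge} {a : HoneycombVertex m N}
    (h : L.rightPt = L'.rightPt) (ha : MarksLeft L.leftPt a) (ha' : MarksLeft L'.leftPt a) :
    L = L' := by
  have h1 := ha.2.symm.trans ha'.2
  obtain ⟨⟨p, q⟩, ν⟩ := L
  obtain ⟨⟨p', q'⟩, ν'⟩ := L'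
  cases ν <;> cases ν' <;> simp [Lozenge.leftPt, Lozenge.rightPt, level] at h h1 ⊢ <;> omega

/-- Lozenges that come from the same edge of the honeycomb cylinder differ by a number of
periods. -/
theorem Lozenge.Joins.eq_translate {L L' : Lozenge} {a b : HoneycombVertex m N}
    (h : L.Joins a b) (h' : L'.Joins a b) : ∃ j, L = L'.translate (period m j) := by
  obtain ⟨j, hj⟩ := h.1.eq_add_period h'.1
  refine ⟨j, eq_of_marksRight (by rw [leftPt_translate, hj]) h.2 ?_⟩
  rw [rightPt_translate, marksRight_add_period]
  exact h'.2

/-- The subgraph of the honeycomb cylinder formed by the edges that come from the lozenges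
in `T`. -/
def tilingSubgraph [NeZero m] (T : Set Lozenge) : (honeycombCylinder m N).Subgraph where
  verts := Set.univ
  Adj a b := ∃ L ∈ T, L.Joins a b ∨ L.Joins b a
  adj_sub := by
    rintro a b ⟨L, -, h | h⟩
    · exact h.adj
    · exact h.adj.symm
  edge_vert _ := Set.mem_univ _
  symm := ⟨fun a b ⟨L, hL, h⟩ => ⟨L, hL, h.symm⟩⟩

/-- The set of lozenges that come from the edges of a subgraph of the honeycomb cylinder. -/
def matchingLozenges (M : (honeycombCylinder m N).Subgraph) : Set Lozenge :=
  {L | ∃ a b, L.Joins a b ∧ M.Adj a b}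

theorem translate_mem_matchingLozenges (M : (honeycombCylinder m N).Subgraph) (j : ℤ)
    (L : Lozenge) : L.translate (period m j) ∈ matchingLozenges M ↔ L ∈ matchingLozenges M := by
  simp only [matchingLozenges, Set.mem_ofPred_eq, joins_translate]

theorem tilingSubgraph_adj_iff [NeZero m] {T : Set Lozenge}
    (hper : ∀ L : Lozenge, L ∈ T ↔ L.translate ((m : ℤ), -(m : ℤ)) ∈ T) {L : Lozenge}
    {a b : HoneycombVertex m N} (h : L.Joins a b) : (tilingSubgraph T).Adj a b ↔ L ∈ T := by
  refine ⟨?_, fun hL => ⟨L, hL, .inl h⟩⟩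
  rintro ⟨L', hL', h' | h'⟩
  · obtain ⟨j, rfl⟩ := h.eq_translate h'
    exact (mem_iff_translate_period hper j L').1 hL'
  · exact absurd h.1.isTop h'.2.not_isTop

theorem isPerfectMatching_tilingSubgraph [NeZero m] {T : Set Lozenge}
    (hT : IsLozengeTiling N T)
    (hper : ∀ L : Lozenge, L ∈ T ↔ L.translate ((m : ℤ), -(m : ℤ)) ∈ T) :
    (tilingSubgraph T : (honeycombCylinder m N).Subgraph).IsPerfectMatching := by
  refine ⟨fun v _ => ?_, fun v => Set.mem_univ v⟩
  by_cases hv : IsTop v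
  · obtain ⟨P, hP⟩ := exists_left_of_isTop hv
    obtain ⟨L, ⟨hL, rfl⟩, -⟩ := ((isLozengeTiling_iff N T).1 hT).2.1 P hP.level_bounds.1
      hP.level_bounds.2
    obtain ⟨-, -, h3, h4⟩ := inStrip_of_mem hT hL
    obtain ⟨w, hw⟩ := exists_marksRight (m := m) h3 h4
    refine ⟨w, ⟨L, hL, .inl ⟨hP, hw⟩⟩, ?_⟩
    rintro w' ⟨L', hL', h' | h'⟩
    · obtain ⟨j, hj⟩ := hP.eq_add_period h'.1
      obtain rfl : L = L'.translate (period m j) :=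
        eq_of_leftPt_eq hT hL ((mem_iff_translate_period hper j L').1 hL')
          (by rw [leftPt_translate, hj])
      rw [rightPt_translate, marksRight_add_period] at hw
      exact h'.2.unique hw
    · exact absurd hv h'.2.not_isTop
  · obtain ⟨P, hP⟩ := exists_right_of_not_isTop hv
    obtain ⟨L, ⟨hL, rfl⟩, -⟩ := ((isLozengeTiling_iff N T).1 hT).2.2 P hP.level_bounds.1
      hP.level_bounds.2
    obtain ⟨h3, h4, -, -⟩ := inStrip_of_mem hT hL
    obtain ⟨w, hw⟩ := exists_marksLeft (m := m) h3 h4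
    refine ⟨w, ⟨L, hL, .inr ⟨hw, hP⟩⟩, ?_⟩
    rintro w' ⟨L', hL', h' | h'⟩
    · exact absurd h'.1.isTop hv
    · obtain ⟨j, hj⟩ := hP.eq_add_period h'.2
      obtain rfl : L = L'.translate (period m j) :=
        eq_of_rightPt_eq hT hL ((mem_iff_translate_period hper j L').1 hL')
          (by rw [rightPt_translate, hj])
      rw [leftPt_translate, marksLeft_add_period] at hw
      exact h'.1.unique hw

theorem isLozengeTiling_matchingLozenges [NeZero m] {M : (honeycombCylinder m N).Subgraph}
    (hM : M.IsPerfectMatching) : IsLozengeTiling N (matchingLozenges M) := by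
  rw [isLozengeTiling_iff]
  refine ⟨?_, fun P h0 hN => ?_, fun P h0 hN => ?_⟩
  · rintro L ⟨a, b, h, -⟩
    exact ⟨h.1.level_bounds.1, h.1.level_bounds.2, h.2.level_bounds.1, h.2.level_bounds.2⟩
  · obtain ⟨a, ha⟩ := exists_marksLeft (m := m) h0 hN
    obtain ⟨b, hab, hu⟩ := hM.1 (hM.2 a)
    obtain ⟨L, rfl, hL⟩ := exists_joins_of_adj hab.adj_sub ha
    refine ⟨L, ⟨⟨a, b, hL, hab⟩, rfl⟩, ?_⟩
    rintro L' ⟨⟨a', b', h', hab'⟩, he⟩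
    obtain rfl : a' = a := h'.1.unique (he ▸ ha)
    obtain rfl := hu b' hab'
    exact eq_of_marksRight he h'.2 hL.2
  · obtain ⟨b, hb⟩ := exists_marksRight (m := m) h0 hN
    obtain ⟨a, hba, hu⟩ := hM.1 (hM.2 b)
    have ha : IsTop a := (isTop_iff_of_adj hba.adj_sub.symm).2 hb.not_isTop
    obtain ⟨Q, hQ⟩ := exists_left_of_isTop ha
    obtain ⟨L, rfl, hL⟩ := exists_joins_of_adj hba.adj_sub.symm hQ
    obtain ⟨j, hj⟩ := hb.eq_add_period hL.2
    have hL' : (L.translate (period m j)).Joins a b := (joins_translate L j a b).2 hL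
    have hR : (L.translate (period m j)).rightPt = P := by rw [rightPt_translate, hj]
    refine ⟨L.translate (period m j), ⟨⟨a, b, hL', hba.symm⟩, hR⟩, ?_⟩
    rintro L' ⟨⟨a', b', h', hab'⟩, he⟩
    obtain rfl : b' = b := h'.2.unique (he ▸ hb)
    obtain rfl := hu a' hab'.symm
    exact eq_of_marksLeft (he.trans hR.symm) h'.1 hL'.1

theorem matchingLozenges_tilingSubgraph [NeZero m] {T : Set Lozenge} (hT : IsLozengeTiling N T)
    (hper : ∀ L : Lozenge, L ∈ T ↔ L.translate ((m : ℤ), -(m : ℤ)) ∈ T) :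
    matchingLozenges (tilingSubgraph T : (honeycombCylinder m N).Subgraph) = T := by
  ext L
  constructor
  · rintro ⟨a, b, h, hab⟩
    exact (tilingSubgraph_adj_iff hper h).1 hab
  · intro hL
    obtain ⟨h1, h2, h3, h4⟩ := inStrip_of_mem hT hL
    obtain ⟨a, ha⟩ := exists_marksLeft (m := m) h1 h2
    obtain ⟨b, hb⟩ := exists_marksRight (m := m) h3 h4
    exact ⟨a, b, ⟨ha, hb⟩, L, hL, .inl ⟨ha, hb⟩⟩

theorem tilingSubgraph_matchingLozenges [NeZero m] {M : (honeycombCylinder m N).Subgraph}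
    (hM : M.IsPerfectMatching) : tilingSubgraph (matchingLozenges M) = M := by
  have key : ∀ a b : HoneycombVertex m N, IsTop a →
      ((tilingSubgraph (matchingLozenges M)).Adj a b ↔ M.Adj a b) := by
    intro a b hta
    constructor
    · rintro ⟨L, ⟨a', b', h', hab'⟩, h | h⟩
      · rwa [h.1.unique h'.1, h.2.unique h'.2]
      · exact absurd hta h.2.not_isTop
    · intro hab
      obtain ⟨P, hP⟩ := exists_left_of_isTop hta
      obtain ⟨L, -, hL⟩ := exists_joins_of_adj hab.adj_sub hP
      exact ⟨L, ⟨a, b, hL, hab⟩, .inl hL⟩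
  refine SimpleGraph.Subgraph.ext ?_ ?_
  · rw [SimpleGraph.Subgraph.isSpanning_iff.1 hM.2]
    rfl
  · ext a b
    by_cases ha : IsTop a
    · exact key a b ha
    · constructor
      · intro h
        exact ((key b a ((isTop_iff_of_adj h.adj_sub.symm).2 ha)).1 h.symm).symm
      · intro h
        exact ((key b a ((isTop_iff_of_adj h.adj_sub.symm).2 ha)).2 h.symm).symm

end Vertices

/-! ### Counting horizontal lozenges -/

/-- The number of horizontal lozenges per period, computed from the height function by summation
of the differences along vertical edges. -/
theorem sum_ind {m k : ℕ} {T : Set Lozenge} (hT : IsLozengeTiling k T)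
    (hper : ∀ L : Lozenge, L ∈ T ↔ L.translate ((m : ℤ), -(m : ℤ)) ∈ T) :
    ∑ x ∈ Finset.range k, ∑ q ∈ Finset.range m, ind T ⟨((x : ℤ) - q, (q : ℤ)), .z⟩ =
      m * (k + 2 * height T (k, 0)) := by
  -- the sum of the heights over a period of a horizontal row
  set S : ℕ → ℤ := fun x => ∑ q ∈ Finset.range m, height T ((x : ℤ) - q, (q : ℤ)) with hS
  have hrow : ∀ x < k, ∑ q ∈ Finset.range m, ind T ⟨((x : ℤ) - q, (q : ℤ)), .z⟩ =
      m - S x + S (x + 2) := by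
    intro x hx
    have h1 : S (x + 2) = ∑ q ∈ Finset.range m, height T ((x : ℤ) - q + 1, (q : ℤ) + 1) := by
      have h2 := Finset.sum_range_succ (fun q : ℕ => height T ((x : ℤ) + 2 - q, (q : ℤ))) m
      rw [Finset.sum_range_succ'] at h2
      have h3 := height_translate hper ((x : ℤ) + 2 - m) m
      rw [sub_add_cancel, sub_self] at h3
      simp only [Nat.cast_zero, sub_zero] at h2
      rw [h3] at h2
      simp only [hS]
      push_cast
      rw [← add_right_cancel h2]
      refine Finset.sum_congr rfl fun q _ => ?_
      push_cast
      congr 2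
      ring
    have h4 : ∀ q ∈ Finset.range m, ind T ⟨((x : ℤ) - q, (q : ℤ)), .z⟩ =
        1 - height T ((x : ℤ) - q, (q : ℤ)) + height T ((x : ℤ) - q + 1, (q : ℤ) + 1) := by
      intro q _
      have := height_add_xy hT ((x : ℤ) - q) q (by simp [level]) (by simpa [level] using hx)
      omega
    rw [Finset.sum_congr rfl h4, Finset.sum_add_distrib, Finset.sum_sub_distrib, ← h1]
    simp [hS]
  have htel : ∀ y : ℕ, y ≤ k →
      ∑ x ∈ Finset.range y, ∑ q ∈ Finset.range m, ind T ⟨((x : ℤ) - q, (q : ℤ)), .z⟩ =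
        m * y - S 0 - S 1 + S y + S (y + 1) := by
    intro y
    induction y with
    | zero => intro _; simp; ring
    | succ y ih =>
      intro hy
      rw [Finset.sum_range_succ, ih (by omega), hrow y (by omega)]
      push_cast
      ring
  have h0 : S 0 = 0 := Finset.sum_eq_zero fun q _ => height_of_level_eq_zero T (by simp [level])
  have h1 : S 1 = 0 := Finset.sum_eq_zero fun q _ => height_upper hT (.inr (by simp [level]))
  have hk : S k = m * height T (k, 0) := by
    simp only [hS]
    rw [Finset.sum_congr rfl fun q _ => height_lower hT (.inl (by simp [level]))]
    simp
  have hk1 : S (k + 1) = m * height T (k, 0) := by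
    simp only [hS]
    rw [Finset.sum_congr rfl fun q _ => height_lower hT (.inr (by simp [level]))]
    simp
  rw [htel k le_rfl, h0, h1, hk, hk1]
  ring

theorem exists_fundamental {m : ℕ} [NeZero m] (P : Point2) :
    ∃ (j : ℤ) (q : Fin m), P + period m j = (level P - q.val, (q.val : ℤ)) := by
  have hm : (0 : ℤ) < m := by exact_mod_cast Nat.pos_of_ne_zero (NeZero.ne m)
  have h1 := Int.emod_nonneg P.2 hm.ne'
  have h2 := Int.emod_lt_of_pos P.2 hm
  refine ⟨P.2 / m, ⟨(P.2 % m).toNat, by omega⟩, ?_⟩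
  have h3 := Int.mul_ediv_add_emod P.2 m
  simp only [period, level, Prod.ext_iff, Prod.fst_add, Prod.snd_add, Int.toNat_of_nonneg h1]
  constructor <;> linarith

theorem encard_vertical {m k : ℕ} [NeZero m] {T : Set Lozenge} (hT : IsLozengeTiling k T)
    (hper : ∀ L : Lozenge, L ∈ T ↔ L.translate ((m : ℤ), -(m : ℤ)) ∈ T) :
    ∃ r : ℕ, ((tilingSubgraph T).edgeSet ∩ verticalEdges m k).encard = r ∧
      (r : ℤ) = m * (k + 2 * height T (k, 0)) := by
  classical
  -- `pt c` ranges over a fundamental domain of the left triangles in the strip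
  let pt : Fin m × Fin k → Point2 := fun c => ((c.2.val : ℤ) - c.1.val, (c.1.val : ℤ))
  let vl : Fin m × Fin k → HoneycombVertex m k := fun c =>
    (((pt c).1 - (pt c).2 - 1 : ℤ), c.2)
  let A : Finset (Fin m × Fin k) := Finset.univ.filter fun c => (⟨pt c, .z⟩ : Lozenge) ∈ T
  have hvl : ∀ c, MarksLeft (pt c) (vl c) := fun c => ⟨rfl, by simp [vl, pt, level]⟩
  have hvr : ∀ P (a : HoneycombVertex m k), MarksLeft P a → MarksRight P (a.1 + 1, a.2) :=
    fun P a h => ⟨by rw [h.1, Int.cast_sub _ 1, Int.cast_one, sub_add_cancel], h.2⟩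
  have hj : ∀ P (a : HoneycombVertex m k), MarksLeft P a →
      (⟨P, .z⟩ : Lozenge).Joins a (a.1 + 1, a.2) := fun P a h => ⟨h, hvr P a h⟩
  have hinj : Function.Injective fun c => s(vl c, ((vl c).1 + 1, (vl c).2)) := by
    intro c c' h
    rcases Sym2.eq_iff.1 h with ⟨h, -⟩ | ⟨h, -⟩
    · obtain ⟨j, hj⟩ := (hvl c).eq_add_period (h ▸ hvl c')
      have h2 : c.2 = c'.2 := congrArg (fun v : HoneycombVertex m k => v.2) h
      refine Prod.ext (Fin.ext ?_) h2
      have h3 := congrArg Prod.snd hj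
      simp only [pt, period, Prod.snd_add] at h3
      have h4 : ((c.1.val : ℕ) : ℤ) % m = (c'.1.val : ℕ) % m := by
        rw [h3, ← sub_eq_add_neg, Int.sub_mul_emod_self_right]
      rw [Int.emod_eq_of_lt (by omega) (by omega), Int.emod_eq_of_lt (by omega) (by omega)] at h4
      exact_mod_cast h4
    · exact absurd (h ▸ (hvl c).isTop) (hvr _ _ (hvl c')).not_isTop
  have himg : (tilingSubgraph T).edgeSet ∩ verticalEdges m k =
      (fun c => s(vl c, ((vl c).1 + 1, (vl c).2))) '' (A : Set (Fin m × Fin k)) := by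
    ext e
    constructor
    · rintro ⟨he, a, hta, rfl⟩
      obtain ⟨P, hP⟩ := exists_left_of_isTop hta
      obtain ⟨j, q, hq⟩ := exists_fundamental (m := m) P
      rw [← hP.2] at hq
      rw [← marksLeft_add_period P j, hq] at hP
      have ha : vl (q, a.2) = a := (hvl (q, a.2)).unique hP
      refine ⟨(q, a.2), ?_, by simp only [ha]⟩
      simp only [A, Finset.coe_filter, Finset.mem_univ, true_and, Set.mem_ofPred_eq]
      exact (tilingSubgraph_adj_iff hper (hj _ _ hP)).1 he
    · rintro ⟨c, hc, rfl⟩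
      simp only [A, Finset.coe_filter, Finset.mem_univ, true_and, Set.mem_ofPred_eq] at hc
      exact ⟨(tilingSubgraph_adj_iff hper (hj _ _ (hvl c))).2 hc, vl c, (hvl c).isTop, rfl⟩
  refine ⟨A.card, ?_, ?_⟩
  · rw [himg, hinj.encard_image, Set.encard_coe_eq_coe_finsetCard]
  · rw [← sum_ind hT hper, Finset.card_filter]
    push_cast
    rw [Fintype.sum_prod_type_right, Finset.sum_range]
    refine Finset.sum_congr rfl fun x _ => ?_
    rw [Finset.sum_range]
    rfl

theorem encard_vertical_eq_iff {m k : ℕ} [NeZero m] {T : Set Lozenge} (hT : IsLozengeTiling k T)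
    (hper : ∀ L : Lozenge, L ∈ T ↔ L.translate ((m : ℤ), -(m : ℤ)) ∈ T) (s : ℕ) :
    ((tilingSubgraph T).edgeSet ∩ verticalEdges m k).encard = (m * s : ℕ) ↔
      (s : ℤ) = k + 2 * height T (k, 0) := by
  obtain ⟨r, hr, hr'⟩ := encard_vertical hT hper
  have hm : (m : ℤ) ≠ 0 := by exact_mod_cast NeZero.ne m
  rw [hr, Nat.cast_inj, ← mul_right_inj' hm, ← hr']
  norm_cast
  exact eq_comm

theorem nonempty_tilings_equiv_matchings {m : ℕ} [NeZero m] (k s : ℕ) :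
    Nonempty (periodicTilings m k s ≃ matchingsWithVertical m k (m * s)) := by
  refine ⟨⟨fun T => ⟨tilingSubgraph T.1, ?_⟩, fun M => ⟨matchingLozenges M.1, ?_⟩, ?_, ?_⟩⟩
  · obtain ⟨hT, hs, hper⟩ := (mem_periodicTilings_iff _ _ _ _).1 T.2
    exact ⟨isPerfectMatching_tilingSubgraph hT hper, (encard_vertical_eq_iff hT hper s).2 hs⟩
  · have hT := isLozengeTiling_matchingLozenges M.2.1
    have hper : ∀ L : Lozenge, L ∈ matchingLozenges M.1 ↔
        L.translate ((m : ℤ), -(m : ℤ)) ∈ matchingLozenges M.1 := fun L => by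
      rw [← translate_mem_matchingLozenges M.1 1 L, period, one_mul]
    refine (mem_periodicTilings_iff _ _ _ _).2 ⟨hT, ?_, hper⟩
    rw [← encard_vertical_eq_iff hT hper, tilingSubgraph_matchingLozenges M.2.1]
    exact M.2.2
  · intro T
    obtain ⟨hT, hs, hper⟩ := (mem_periodicTilings_iff _ _ _ _).1 T.2
    exact Subtype.ext (matchingLozenges_tilingSubgraph hT hper)
  · intro M
    exact Subtype.ext (tilingSubgraph_matchingLozenges M.2.1)

/-! ### Tilings and families of non-intersecting paths -/

/-- Levels increase along a path, so a path covers no unit triangle twice. -/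
theorem SlashPath.eq_of_mem {Q R : Point2} {l : List Lozenge} (h : SlashPath Q l R)
    {L L' : Lozenge} (hL : L ∈ l) (hL' : L' ∈ l)
    (he : L.leftPt = L'.leftPt ∨ L.rightPt = L'.rightPt) : L = L' := by
  induction h with
  | nil => simp at hL
  | @cons L₀ l Q Q₁ R hs hp ih =>
    obtain ⟨h1, rfl, rfl⟩ := (slashStep_iff _ _ _).1 hs
    have key : ∀ L'' ∈ l, ¬ (L₀.leftPt = L''.leftPt ∨ L₀.rightPt = L''.rightPt) := by
      intro L'' hL'' he
      obtain ⟨h2, h3, -⟩ := hp.level_of_mem hL''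
      have h4 := level_leftPt_le h1
      have h5 := level_leftPt_le h2
      rw [level_add_one] at h3
      rcases he with he | he <;> have he := congrArg level he <;> omega
    rcases List.mem_cons.1 hL with rfl | hm <;> rcases List.mem_cons.1 hL' with rfl | hm'
    · rfl
    · exact absurd he (key L' hm')
    · exact absurd (he.imp Eq.symm Eq.symm) (key L hm)
    · exact ih hm hm'

theorem SlashPath.map_translate {Q R : Point2} {l : List Lozenge} (h : SlashPath Q l R)
    (w : Point2) : SlashPath (Q + w) (l.map (Lozenge.translate w)) (R + w) := by
  induction h with
  | nil => exact .nil _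
  | cons hs hp ih =>
    refine .cons ?_ ih
    rw [slashStep_iff] at hs ⊢
    obtain ⟨h1, rfl, rfl⟩ := hs
    exact ⟨h1, leftPt_translate _ _, by rw [rightPt_translate, add_right_comm]⟩

theorem translate_injective (w : Point2) : Function.Injective (Lozenge.translate w) := by
  intro L L' h
  have h1 := congrArg Lozenge.corner h
  have h2 := congrArg Lozenge.normal h
  exact Lozenge.ext (add_right_cancel h1) h2

theorem level_add_period (m : ℕ) (P : Point2) : level (P + ((m : ℤ), -(m : ℤ))) = level P := by
  simp [level]; ring

theorem inStrip_translate (m k : ℕ) (L : Lozenge) :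
    (L.translate ((m : ℤ), -(m : ℤ))).InStrip k ↔ L.InStrip k := by
  simp only [Lozenge.InStrip, leftPt_translate, rightPt_translate, level_add_period]

/-- Paths are disjoint if they have no left and no right triangle in common. -/
theorem disjoint_iff (p : ℤ → List Lozenge) :
    (∀ i j, i ≠ j → ∀ L ∈ p i, ∀ L' ∈ p j, ∀ t : Triangle,
      ¬ (t.vertices ⊆ L.vertices ∧ t.vertices ⊆ L'.vertices)) ↔
    ∀ i j, i ≠ j → ∀ L ∈ p i, ∀ L' ∈ p j, L.leftPt ≠ L'.leftPt ∧ L.rightPt ≠ L'.rightPt := by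
  constructor
  · intro h i j hij L hL L' hL'
    refine ⟨fun he => h i j hij L hL L' hL' (.left L.leftPt) ?_,
      fun he => h i j hij L hL L' hL' (.right L.rightPt) ?_⟩
    · rw [left_subset_iff, left_subset_iff]
      exact ⟨rfl, he.symm⟩
    · rw [right_subset_iff, right_subset_iff]
      exact ⟨rfl, he.symm⟩
  · rintro h i j hij L hL L' hL' (P | P)
    · rw [left_subset_iff, left_subset_iff]
      exact fun ht => (h i j hij L hL L' hL').1 (ht.1.trans ht.2.symm)
    · rw [right_subset_iff, right_subset_iff]
      exact fun ht => (h i j hij L hL L' hL').2 (ht.1.trans ht.2.symm)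

/-- The lozenges of a family of paths, together with the lozenges with normal `y` that fill the gaps
between the paths. -/
def familyLozenges (k : ℕ) (p : ℤ → List Lozenge) : Set Lozenge :=
  {L | (∃ i, L ∈ p i) ∨ (L.normal = .y ∧ L.InStrip k ∧ ∀ i, ∀ L' ∈ p i, L'.leftPt ≠ L.leftPt)}

theorem eq_of_normal_eq_y {L L' : Lozenge} (h : L.normal = .y) (h' : L'.normal = .y)
    (he : L.leftPt = L'.leftPt ∨ L.rightPt = L'.rightPt) : L = L' := by
  have h1 := leftPt_of_normal_eq_y h
  have h2 := leftPt_of_normal_eq_y h'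
  rcases he with he | he
  · exact eq_of_leftPt_eq_of_rightPt_eq he (add_right_cancel (h1.symm.trans (he.trans h2)))
  · exact eq_of_leftPt_eq_of_rightPt_eq (by rw [h1, h2, he]) he

/-- The number of horizontal lozenges determines the end point of a path. Hence, if it is the same for
all paths of a family, the paths reach all slash edges of the lower boundary. -/
theorem SlashPath.end_of_countP {n s : ℕ} {i : ℤ} {R : Point2} {l : List Lozenge}
    (h : SlashPath (i, -i) l R) (hR : level R = (2 * n + s : ℕ))
    (hs : l.countP Lozenge.isHorizontal = s) : R = (i + n + s, -i + n) := by
  have h1 := h.end_eq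
  rw [h1] at hR ⊢
  simp only [level, Prod.fst_add, Prod.snd_add, hs] at hR ⊢
  push_cast at hR
  simp only [Prod.mk_add_mk, Prod.mk.injEq]
  constructor <;> omega

theorem isLozengeTiling_familyLozenges {n s : ℕ} {p : ℤ → List Lozenge}
    (hp : ∀ i, IsLozengePath (2 * n + s) i (p i) ∧ (p i).countP Lozenge.isHorizontal = s)
    (hd : ∀ i j, i ≠ j → ∀ L ∈ p i, ∀ L' ∈ p j,
      L.leftPt ≠ L'.leftPt ∧ L.rightPt ≠ L'.rightPt) :
    IsLozengeTiling (2 * n + s) (familyLozenges (2 * n + s) p) := by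
  set k := 2 * n + s with hk
  have hpath : ∀ i, SlashPath (i, -i) (p i) (i + n + s, -i + n) := fun i => by
    obtain ⟨⟨R, hR, h⟩, -⟩ := (hp i).1
    rwa [h.end_of_countP hR (hp i).2] at h
  have hend : ∀ i : ℤ, level (i + n + s, -i + n) = k := fun i => by
    simp only [level, hk]
    push_cast
    ring
  have hstrip : ∀ i, ∀ L ∈ p i, L.InStrip k := fun i L hL =>
    (lozenge_in_strip_iff k L).1 ((hp i).1.2 L hL)
  have hne : 0 < k → ∀ i : ℤ, ((i, -i) : Point2) ≠ (i + n + s, -i + n) := fun hk0 i he => by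
    have := hend i
    rw [← he, level_diag] at this
    omega
  have heq : ∀ i j, ∀ L ∈ p i, ∀ L' ∈ p j,
      (L.leftPt = L'.leftPt ∨ L.rightPt = L'.rightPt) → L = L' := by
    intro i j L hL L' hL' he
    by_cases hij : i = j
    · subst hij
      exact (hpath i).eq_of_mem hL hL' he
    · have := hd i j hij L hL L' hL'
      tauto
  -- a gap-filling lozenge shares no right triangle with a path either
  have hright : ∀ i, ∀ L ∈ p i, ∀ L' : Lozenge, L'.normal = .y → L'.InStrip k →
      (∀ i, ∀ L'' ∈ p i, L''.leftPt ≠ L'.leftPt) → L.rightPt ≠ L'.rightPt := by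
    intro i L hL L' hy hs hu he
    have h1 := leftPt_of_normal_eq_y hy
    obtain ⟨L'', hL'', h2⟩ := (hpath i).exists_leftPt_eq hL (by
      rw [he, ← h1]
      intro h
      have h3 := hs.2.1
      rw [h, hend] at h3
      omega)
    exact hu i L'' hL'' (by rw [h2, he, h1])
  rw [isLozengeTiling_iff]
  refine ⟨?_, fun P h0 hP => ?_, fun P h0 hP => ?_⟩
  · rintro L (⟨i, hL⟩ | ⟨-, h, -⟩)
    · exact hstrip i L hL
    · exact h
  · refine existsUnique_of_exists_of_unique ?_ ?_
    · by_cases hc : ∃ i, ∃ L ∈ p i, L.leftPt = P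
      · obtain ⟨i, L, hL, hLP⟩ := hc
        exact ⟨L, .inl ⟨i, hL⟩, hLP⟩
      · push Not at hc
        refine ⟨⟨(P.1, P.2 + 1), .y⟩, .inr ⟨rfl, ?_, ?_⟩, by simp [Lozenge.leftPt]⟩
        · have hP0 : level P ≠ 0 := by
            intro h
            obtain ⟨L, hL, hLP⟩ := (hpath P.1).exists_leftPt_eq_start (hne (by omega) P.1)
            refine hc _ L hL (hLP.trans (Prod.ext rfl ?_))
            simp only [level] at h
            simp only
            omega
          simp only [Lozenge.InStrip, Lozenge.leftPt, Lozenge.rightPt, level] at hP0 h0 hP ⊢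
          omega
        · simpa [Lozenge.leftPt] using hc
    · rintro L L' ⟨hL | ⟨hy, -, hu⟩, hLP⟩ ⟨hL' | ⟨hy', -, hu'⟩, hLP'⟩
      · obtain ⟨i, hL⟩ := hL
        obtain ⟨j, hL'⟩ := hL'
        exact heq i j L hL L' hL' (.inl (hLP.trans hLP'.symm))
      · obtain ⟨i, hL⟩ := hL
        exact absurd (hLP.trans hLP'.symm) (hu' i L hL)
      · obtain ⟨j, hL'⟩ := hL'
        exact absurd (hLP'.trans hLP.symm) (hu j L' hL')
      · exact eq_of_normal_eq_y hy hy' (.inl (hLP.trans hLP'.symm))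
  · refine existsUnique_of_exists_of_unique ?_ ?_
    · by_cases hc : ∃ i, ∃ L ∈ p i, L.rightPt = P
      · obtain ⟨i, L, hL, hLP⟩ := hc
        exact ⟨L, .inl ⟨i, hL⟩, hLP⟩
      · push Not at hc
        refine ⟨⟨(P.1 + 1, P.2 + 1), .y⟩, .inr ⟨rfl, ?_, ?_⟩, by simp [Lozenge.rightPt]⟩
        · have hP0 : level P + 1 ≠ k := by
            intro h
            obtain ⟨L, hL, hLP⟩ := (hpath (P.1 + 1 - n - s)).exists_rightPt_eq_end
              (hne (by omega) _)
            refine hc _ L hL (add_right_cancel (hLP.trans (Prod.ext ?_ ?_)))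
            · simp only [Prod.fst_add]
              ring
            · simp only [level, hk] at h
              push_cast at h
              simp only [Prod.snd_add]
              omega
          simp only [Lozenge.InStrip, Lozenge.leftPt, Lozenge.rightPt, level] at hP0 h0 hP ⊢
          omega
        · intro i L hL he
          have h1 : L.leftPt = P + (1, 0) := by
            rw [he]
            simp [Lozenge.leftPt, Prod.ext_iff]
          obtain ⟨L', hL', h2⟩ := (hpath i).exists_rightPt_eq hL (fun h => by
            have h3 := level_add_one P
            rw [← h1, h, level_diag] at h3
            omega)
          exact hc i L' hL' (add_right_cancel (h2.trans h1))
    · rintro L L' ⟨hL | ⟨hy, hs, hu⟩, hLP⟩ ⟨hL' | ⟨hy', hs', hu'⟩, hLP'⟩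
      · obtain ⟨i, hL⟩ := hL
        obtain ⟨j, hL'⟩ := hL'
        exact heq i j L hL L' hL' (.inr (hLP.trans hLP'.symm))
      · obtain ⟨i, hL⟩ := hL
        exact absurd (hLP.trans hLP'.symm) (hright i L hL L' hy' hs' hu')
      · obtain ⟨j, hL'⟩ := hL'
        exact absurd (hLP'.trans hLP.symm) (hright j L' hL' L hy hs hu)
      · exact eq_of_normal_eq_y hy hy' (.inr (hLP.trans hLP'.symm))

theorem familyLozenges_mem_periodicTilings {m n s : ℕ} {p : ℤ → List Lozenge}
    (h : p ∈ periodicPathFamilies m (2 * n + s) s) :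
    familyLozenges (2 * n + s) p ∈ periodicTilings m (2 * n + s) s := by
  obtain ⟨hp, hd, hper⟩ := h
  have hT := isLozengeTiling_familyLozenges hp ((disjoint_iff p).1 hd)
  refine ⟨hT, fun i l hl hlT => ?_, fun L => ?_⟩
  · rw [lozengePath_unique hT hl (hp i).1 hlT fun L hL => .inl ⟨i, hL⟩, (hp i).2]
  · have h1 : ∀ L i, L.translate ((m : ℤ), -(m : ℤ)) ∈ p (i + m) ↔ L ∈ p i := fun L i => by
      rw [hper, List.mem_map_of_injective (translate_injective _)]
    have h2 : (∃ i, L ∈ p i) ↔ ∃ i, L.translate ((m : ℤ), -(m : ℤ)) ∈ p i :=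
      ⟨fun ⟨i, hi⟩ => ⟨i + m, (h1 L i).2 hi⟩,
        fun ⟨i, hi⟩ => ⟨i - m, (h1 L (i - m)).1 (by rwa [sub_add_cancel])⟩⟩
    have h3 : (∀ i, ∀ L' ∈ p i, L'.leftPt ≠ L.leftPt) ↔
        ∀ i, ∀ L' ∈ p i, L'.leftPt ≠ (L.translate ((m : ℤ), -(m : ℤ))).leftPt := by
      rw [leftPt_translate]
      constructor
      · intro h i L' hL' he
        rw [← sub_add_cancel i (m : ℤ), hper] at hL'
        obtain ⟨L'', hL'', rfl⟩ := List.mem_map.1 hL'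
        rw [leftPt_translate] at he
        exact h _ L'' hL'' (add_right_cancel he)
      · intro h i L' hL' he
        exact h (i + m) _ ((h1 L' i).2 hL') (by rw [leftPt_translate, he])
    simp only [familyLozenges, Set.mem_ofPred_eq, h2, h3, inStrip_translate]
    rfl

/-- The path of a tiling that starts at the slash edge `(i, -i)` of the upper boundary. -/
noncomputable def tilingPath {k : ℕ} {T : Set Lozenge} (hT : IsLozengeTiling k T) (i : ℤ) :
    List Lozenge := (exists_lozengePath hT i).choose

section Tiling

variable {k : ℕ} {T : Set Lozenge} (hT : IsLozengeTiling k T)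

theorem isLozengePath_tilingPath (i : ℤ) : IsLozengePath k i (tilingPath hT i) :=
  (exists_lozengePath hT i).choose_spec.1

theorem tilingPath_subset (i : ℤ) : ∀ L ∈ tilingPath hT i, L ∈ T :=
  (exists_lozengePath hT i).choose_spec.2

theorem eq_tilingPath {i : ℤ} {l : List Lozenge} (h : IsLozengePath k i l)
    (hl : ∀ L ∈ l, L ∈ T) : l = tilingPath hT i :=
  lozengePath_unique hT h (isLozengePath_tilingPath hT i) hl (tilingPath_subset hT i)

/-- A lozenge lies on at most one path of a tiling: this is seen by following the paths upwards. -/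
theorem eq_of_mem_tilingPath {i j : ℤ} {L : Lozenge} (hi : L ∈ tilingPath hT i)
    (hj : L ∈ tilingPath hT j) : i = j := by
  have hs := inStrip_of_mem hT (tilingPath_subset hT i L hi)
  obtain ⟨d, hd⟩ : ∃ d : ℕ, level L.leftPt = d := ⟨(level L.leftPt).toNat, by have := hs.1; omega⟩
  induction d using Nat.strong_induction_on generalizing L with
  | _ d ih =>
    obtain ⟨⟨R, -, hpi⟩, -⟩ := isLozengePath_tilingPath hT i
    obtain ⟨⟨R', -, hpj⟩, -⟩ := isLozengePath_tilingPath hT j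
    by_cases h0 : d = 0
    · have key : ∀ {i : ℤ} {R : Point2}, L ∈ tilingPath hT i →
          SlashPath (i, -i) (tilingPath hT i) R → L.leftPt = (i, -i) := by
        intro i R hi hp
        by_contra hne
        obtain ⟨L', hL', h1⟩ := hp.exists_rightPt_eq hi hne
        have h2 := (inStrip_of_mem hT (tilingPath_subset hT i L' hL')).2.2.1
        have h3 := level_add_one L'.rightPt
        rw [h1] at h3
        omega
      exact congrArg Prod.fst ((key hi hpi).symm.trans (key hj hpj))
    · have hne : ∀ i : ℤ, L.leftPt ≠ (i, -i) := fun i h => by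
        rw [h, level_diag] at hd
        omega
      obtain ⟨L', hL', h1⟩ := hpi.exists_rightPt_eq hi (hne i)
      obtain ⟨L'', hL'', h2⟩ := hpj.exists_rightPt_eq hj (hne j)
      obtain rfl := eq_of_rightPt_eq hT (tilingPath_subset hT i L' hL')
        (tilingPath_subset hT j L'' hL'') (add_right_cancel (h1.trans h2.symm))
      have hs' := inStrip_of_mem hT (tilingPath_subset hT i L' hL')
      have h3 := level_leftPt_le (hpi.level_of_mem hL').1
      have h4 := level_add_one L'.rightPt
      rw [h1] at h4
      have h5 := hs'.1
      exact ih (level L'.leftPt).toNat (by omega) hL' hL'' hs' (by omega)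

theorem tilingPath_mem_periodicPathFamilies {m s : ℕ} (h : T ∈ periodicTilings m k s) :
    tilingPath hT ∈ periodicPathFamilies m k s := by
  refine ⟨fun i => ⟨isLozengePath_tilingPath hT i,
    h.2.1 i _ (isLozengePath_tilingPath hT i) (tilingPath_subset hT i)⟩, ?_, fun i => ?_⟩
  · rw [disjoint_iff]
    intro i j hij L hL L' hL'
    constructor
    · intro he
      obtain rfl := eq_of_leftPt_eq hT (tilingPath_subset hT i L hL)
        (tilingPath_subset hT j L' hL') he
      exact hij (eq_of_mem_tilingPath hT hL hL')
    · intro he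
      obtain rfl := eq_of_rightPt_eq hT (tilingPath_subset hT i L hL)
        (tilingPath_subset hT j L' hL') he
      exact hij (eq_of_mem_tilingPath hT hL hL')
  · symm
    apply eq_tilingPath
    · obtain ⟨⟨R, hR, hp⟩, -⟩ := isLozengePath_tilingPath hT i
      refine (isLozengePath_iff _ _ _).2
        ⟨R + ((m : ℤ), -(m : ℤ)), by rw [level_add_period, hR], ?_⟩
      convert hp.map_translate ((m : ℤ), -(m : ℤ)) using 1
      simp [add_comm]
    · intro L hL
      obtain ⟨L', hL', rfl⟩ := List.mem_map.1 hL
      exact (h.2.2 L').1 (tilingPath_subset hT i L' hL')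

theorem familyLozenges_tilingPath : familyLozenges k (tilingPath hT) = T := by
  have hon : ∀ L ∈ T, L.normal ≠ .y → ∃ i, L ∈ tilingPath hT i := by
    intro L hL hy
    obtain ⟨i, l, hp, hl, hmem⟩ := exists_lozengePath_mem hT hL hy
    exact ⟨i, eq_tilingPath hT hp hl ▸ hmem⟩
  ext L
  constructor
  · rintro (⟨i, hi⟩ | ⟨hy, hs, hu⟩)
    · exact tilingPath_subset hT i L hi
    · obtain ⟨L', ⟨hL', he⟩, -⟩ := ((isLozengeTiling_iff k T).1 hT).2.1 _ hs.1 hs.2.1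
      by_cases hy' : L'.normal = .y
      · rwa [eq_of_normal_eq_y hy hy' (.inl he.symm)]
      · obtain ⟨i, hi⟩ := hon L' hL' hy'
        exact absurd he (hu i L' hi)
  · intro hL
    by_cases hy : L.normal = .y
    · refine .inr ⟨hy, inStrip_of_mem hT hL, fun i L' hL' he => ?_⟩
      obtain ⟨⟨R, -, hp⟩, -⟩ := isLozengePath_tilingPath hT i
      refine (hp.level_of_mem hL').1 ?_
      rwa [eq_of_leftPt_eq hT (tilingPath_subset hT i L' hL') hL he]
    · exact .inl (hon L hL hy)

end Tiling

theorem nonempty_tilings_equiv_families (m n s : ℕ) :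
    Nonempty (periodicTilings m (2 * n + s) s ≃ periodicPathFamilies m (2 * n + s) s) := by
  refine ⟨⟨fun T => ⟨tilingPath T.2.1, tilingPath_mem_periodicPathFamilies T.2.1 T.2⟩,
    fun p => ⟨familyLozenges _ p.1, familyLozenges_mem_periodicTilings p.2⟩, fun T => ?_,
    fun p => ?_⟩⟩
  · exact Subtype.ext (familyLozenges_tilingPath T.2.1)
  · refine Subtype.ext (funext fun i => ?_)
    exact (eq_tilingPath (familyLozenges_mem_periodicTilings p.2).1 (p.2.1 i).1
      fun L hL => .inl ⟨i, hL⟩).symm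

/-! ### Paths of lozenges as words -/

/-- The path of lozenges from the slash edge `Q` whose horizontal lozenges are prescribed by the
entries `true` of a word. -/
def wordPath : Point2 → List Bool → List Lozenge
  | _, [] => []
  | Q, true :: w => ⟨Q, .z⟩ :: wordPath (Q + (1, 0)) w
  | Q, false :: w => ⟨Q + (1, 1), .x⟩ :: wordPath (Q + (1, 1)) w

/-- The number of letters `false` among the first `t` letters. -/
def falses (w : List Bool) (t : ℕ) : ℕ := (w.take t).count false

theorem slashPath_wordPath (Q : Point2) (w : List Bool) :
    ∃ R, SlashPath Q (wordPath Q w) R := by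
  induction w generalizing Q with
  | nil => exact ⟨Q, .nil Q⟩
  | cons b w ih =>
    cases b
    · obtain ⟨R, h⟩ := ih (Q + (1, 1))
      exact ⟨R, .cons (.vertical Q) h⟩
    · obtain ⟨R, h⟩ := ih (Q + (1, 0))
      exact ⟨R, .cons (.horizontal Q) h⟩

theorem map_isHorizontal_wordPath (Q : Point2) (w : List Bool) :
    (wordPath Q w).map Lozenge.isHorizontal = w := by
  induction w generalizing Q with
  | nil => rfl
  | cons b w ih => cases b <;> simp [wordPath, ih] <;> rfl

theorem SlashPath.eq_wordPath {Q R : Point2} {l : List Lozenge} (h : SlashPath Q l R) :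
    l = wordPath Q (l.map Lozenge.isHorizontal) := by
  induction h with
  | nil => rfl
  | cons hs hp ih =>
    cases hs
    · exact congrArg (List.cons _) ih
    · exact congrArg (List.cons _) ih

theorem wordPath_add (Q v : Point2) (w : List Bool) :
    wordPath (Q + v) w = (wordPath Q w).map (Lozenge.translate v) := by
  induction w generalizing Q with
  | nil => rfl
  | cons b w ih =>
    cases b <;> simp [wordPath, ← ih, Lozenge.translate, add_right_comm]

/-- The triangles covered by the path of a word. -/
theorem exists_of_mem_wordPath {Q : Point2} {w : List Bool} {L : Lozenge}
    (h : L ∈ wordPath Q w) :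
    ∃ t < w.length, L.leftPt = Q + ((t : ℤ), (falses w t : ℤ)) ∧
      L.rightPt + (1, 0) = Q + ((t + 1 : ℤ), (falses w (t + 1) : ℤ)) := by
  induction w generalizing Q with
  | nil => simp [wordPath] at h
  | cons b w ih =>
    cases b
    · rcases List.mem_cons.1 h with rfl | h
      · exact ⟨0, by simp, by simp [Lozenge.leftPt, falses],
          by simp [Lozenge.rightPt, falses, Prod.ext_iff]⟩
      · obtain ⟨t, ht, h1, h2⟩ := ih h
        refine ⟨t + 1, by simpa using ht, ?_, ?_⟩
        · rw [h1]
          simp [falses, Prod.ext_iff]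
          constructor <;> ring
        · rw [h2]
          simp [falses, Prod.ext_iff]
          constructor <;> ring
    · rcases List.mem_cons.1 h with rfl | h
      · exact ⟨0, by simp, by simp [Lozenge.leftPt, falses],
          by simp [Lozenge.rightPt, falses]⟩
      · obtain ⟨t, ht, h1, h2⟩ := ih h
        refine ⟨t + 1, by simpa using ht, ?_, ?_⟩
        · rw [h1]
          simp [falses, Prod.ext_iff]
          ring
        · rw [h2]
          simp [falses, Prod.ext_iff]
          ring

theorem exists_mem_wordPath (Q : Point2) {w : List Bool} {t : ℕ} (ht : t < w.length) :
    ∃ L ∈ wordPath Q w, L.rightPt + (1, 0) = Q + ((t + 1 : ℤ), (falses w (t + 1) : ℤ)) := by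
  induction w generalizing Q t with
  | nil => simp at ht
  | cons b w ih =>
    cases b <;> cases t with
    | zero =>
      exact ⟨_, List.mem_cons_self, by simp [Lozenge.rightPt, falses, Prod.ext_iff]⟩
    | succ t =>
      obtain ⟨L, hL, h⟩ := ih (Q + _) (by simpa using ht)
      refine ⟨L, List.mem_cons_of_mem _ hL, ?_⟩
      rw [h]
      simp [falses, Prod.ext_iff]
      first | (constructor <;> ring) | ring

theorem falses_of_length_le {w : List Bool} {t : ℕ} (h : w.length ≤ t) :
    falses w t = w.count false := by rw [falses, List.take_of_length_le h]

theorem falses_le_count (w : List Bool) (t : ℕ) : falses w t ≤ w.count false :=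
  (List.take_sublist t w).count_le _

theorem falses_succ_le (w : List Bool) (t : ℕ) :
    falses w t ≤ falses w (t + 1) ∧ falses w (t + 1) ≤ falses w t + 1 := by
  induction w generalizing t with
  | nil => simp [falses]
  | cons b w ih =>
    cases t with
    | zero => cases b <;> simp [falses]
    | succ t =>
      have := ih t
      cases b <;> simp [falses] at this ⊢ <;> omega

theorem count_true_add_count_false (w : List Bool) :
    w.count true + w.count false = w.length := by
  induction w with
  | nil => rfl
  | cons b w ih => cases b <;> simp <;> omega

theorem falses_add_count_take (w : List Bool) (t : ℕ) :
    (w.take t).count true + falses w t = min t w.length := by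
  rw [falses, count_true_add_count_false, List.length_take]

/-- The condition on words that expresses that the corresponding paths are
non-intersecting: the path with index `i + 1` remains strictly to the right of that with
index `i`. -/
theorem wordPath_disjoint_iff {n s : ℕ} {w : ℤ → List Bool}
    (hw : ∀ i, (w i).count true = s ∧ (w i).count false = n) :
    (∀ i j, i ≠ j → ∀ L ∈ wordPath (i, -i) (w i), ∀ L' ∈ wordPath (j, -j) (w j),
      L.leftPt ≠ L'.leftPt ∧ L.rightPt ≠ L'.rightPt) ↔
    ∀ i t, falses (w (i + 1)) t ≤ falses (w i) (t + 1) := by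
  have hlen : ∀ i, (w i).length = n + s := fun i => by
    rw [← count_true_add_count_false, (hw i).1, (hw i).2, add_comm]
  constructor
  · intro h i t
    induction t with
    | zero => simp [falses]
    | succ t ih =>
      by_contra hlt
      have h1 := falses_succ_le (w (i + 1)) t
      have h2 := falses_succ_le (w i) (t + 1)
      have ht : t + 1 < n + s := by
        by_contra hge
        have h3 := falses_le_count (w (i + 1)) (t + 1)
        rw [falses_of_length_le (w := w i) (by rw [hlen]; omega), (hw i).2] at hlt
        rw [(hw (i + 1)).2] at h3
        omega
      -- if the inequality fails for the first time then the two paths meet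
      obtain ⟨L, hL, hL1⟩ := exists_mem_wordPath (i, -i) (w := w i) (t := t + 1)
        (by rw [hlen]; omega)
      obtain ⟨L', hL', hL1'⟩ := exists_mem_wordPath (i + 1, -(i + 1)) (w := w (i + 1)) (t := t)
        (by rw [hlen]; omega)
      refine (h i (i + 1) (by simp) L hL L' hL').2 (add_right_cancel (hL1.trans ?_))
      rw [hL1']
      simp only [Prod.mk_add_mk, Prod.mk.injEq]
      constructor
      · push_cast
        ring
      · omega
  · intro h
    have hchain : ∀ (d : ℕ) (i : ℤ) (t : ℕ), falses (w (i + d)) t ≤ falses (w i) (t + d) := by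
      intro d
      induction d with
      | zero => simp
      | succ d ih =>
        intro i t
        have h1 := h (i + d) t
        have h2 := ih i (t + 1)
        rw [show i + ((d + 1 : ℕ) : ℤ) = i + d + 1 by push_cast; ring,
          show t + (d + 1) = t + 1 + d by ring]
        exact h1.trans h2
    have hpos : ∀ i j : ℤ, i < j → ∀ t t' : ℕ,
        ((i, -i) : Point2) + ((t : ℤ), (falses (w i) t : ℤ)) ≠
          (j, -j) + ((t' : ℤ), (falses (w j) t' : ℤ)) := by
      intro i j hij t t' he
      obtain ⟨d, rfl⟩ : ∃ d : ℕ, j = i + d := ⟨(j - i).toNat, by omega⟩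
      simp only [Prod.mk_add_mk, Prod.mk.injEq] at he
      obtain rfl : t = t' + d := by omega
      have := hchain d i t'
      omega
    have hpos' : ∀ i j : ℤ, i ≠ j → ∀ t t' : ℕ,
        ((i, -i) : Point2) + ((t : ℤ), (falses (w i) t : ℤ)) ≠
          (j, -j) + ((t' : ℤ), (falses (w j) t' : ℤ)) := by
      intro i j hij t t'
      rcases hij.lt_or_gt with hij | hij
      · exact hpos i j hij t t'
      · exact (hpos j i hij t' t).symm
    intro i j hij L hL L' hL'
    obtain ⟨t, -, h1, h2⟩ := exists_of_mem_wordPath hL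
    obtain ⟨t', -, h1', h2'⟩ := exists_of_mem_wordPath hL'
    constructor
    · rw [h1, h1']
      exact hpos' i j hij t t'
    · intro he
      have h3 := hpos' i j hij (t + 1) (t' + 1)
      push_cast at h3
      rw [← h2, ← h2', he] at h3
      exact h3 rfl

/-- The `m`-periodic families of words with `s` letters `true` and `n` letters `false` whose paths
are non-intersecting. -/
def periodicWords (m n s : ℕ) : Set (ℤ → List Bool) :=
  {w | (∀ i, (w i).count true = s ∧ (w i).count false = n) ∧
    (∀ i t, falses (w (i + 1)) t ≤ falses (w i) (t + 1)) ∧ ∀ i, w (i + m) = w i}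

theorem count_map_isHorizontal (l : List Lozenge) :
    (l.map Lozenge.isHorizontal).count true = l.countP Lozenge.isHorizontal := by
  rw [List.count, List.countP_map]
  congr 1
  ext L
  simp

theorem isLozengePath_wordPath_iff (n s : ℕ) (i : ℤ) (w : List Bool) :
    (IsLozengePath (2 * n + s) i (wordPath (i, -i) w) ∧
      (wordPath (i, -i) w).countP Lozenge.isHorizontal = s) ↔
    w.count true = s ∧ w.count false = n := by
  have h1 : (wordPath (i, -i) w).countP Lozenge.isHorizontal = w.count true := by
    rw [← count_map_isHorizontal, map_isHorizontal_wordPath]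
  have h2 : (wordPath (i, -i) w).length = w.length := by
    rw [← List.length_map (as := wordPath (i, -i) w) Lozenge.isHorizontal,
      map_isHorizontal_wordPath]
  have h3 := count_true_add_count_false w
  have key : ∀ R, SlashPath (i, -i) (wordPath (i, -i) w) R →
      level R = w.count true + 2 * w.count false := fun R hR => by
    rw [hR.end_eq, h1, h2, ← h3]
    simp only [level, Prod.fst_add, Prod.snd_add]
    push_cast
    ring
  rw [h1, isLozengePath_iff]
  constructor
  · rintro ⟨⟨R, hR, h⟩, hs⟩
    rw [key R h] at hR
    push_cast at hR
    omega
  · rintro ⟨hs, hn⟩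
    obtain ⟨R, h⟩ := slashPath_wordPath (i, -i) w
    refine ⟨⟨R, ?_, h⟩, hs⟩
    rw [key R h, hs, hn]
    push_cast
    ring

theorem wordPath_mem_periodicPathFamilies_iff (m n s : ℕ) (w : ℤ → List Bool) :
    (fun i => wordPath (i, -i) (w i)) ∈ periodicPathFamilies m (2 * n + s) s ↔
      w ∈ periodicWords m n s := by
  simp only [periodicPathFamilies, periodicWords, Set.mem_ofPred_eq, isLozengePath_wordPath_iff]
  refine and_congr_right fun hw => ?_
  rw [disjoint_iff fun i => wordPath (i, -i) (w i), wordPath_disjoint_iff hw]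
  refine and_congr_right fun _ => forall_congr' fun i => ?_
  have h1 : ((i + m, -(i + m)) : Point2) = (i, -i) + ((m : ℤ), -(m : ℤ)) := by
    simp [add_comm]
  rw [h1, ← wordPath_add]
  refine ⟨fun h => ?_, fun h => by rw [h]⟩
  rw [← map_isHorizontal_wordPath _ (w (i + m)), h, map_isHorizontal_wordPath]

theorem nonempty_families_equiv_words (m n s : ℕ) :
    Nonempty (periodicPathFamilies m (2 * n + s) s ≃ periodicWords m n s) := by
  have hp : ∀ p ∈ periodicPathFamilies m (2 * n + s) s,
      (fun i => wordPath (i, -i) ((p i).map Lozenge.isHorizontal)) = p := by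
    intro p hp
    funext i
    obtain ⟨⟨R, -, h⟩, -⟩ := (hp.1 i).1
    exact h.eq_wordPath.symm
  refine ⟨⟨fun p => ⟨fun i => (p.1 i).map Lozenge.isHorizontal, ?_⟩,
    fun w => ⟨fun i => wordPath (i, -i) (w.1 i), ?_⟩, fun p => ?_, fun w => ?_⟩⟩
  · rw [← wordPath_mem_periodicPathFamilies_iff, hp p.1 p.2]
    exact p.2
  · rw [wordPath_mem_periodicPathFamilies_iff]
    exact w.2
  · exact Subtype.ext (hp p.1 p.2)
  · exact Subtype.ext (funext fun i => map_isHorizontal_wordPath _ _)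

/-! ### Words as decreasing sequences -/

/-- The number of letters `false` after the letter `true` with the given index, or `0` if there is
no such letter `true`. -/
def falsesAfter : List Bool → ℕ → ℕ
  | [], _ => 0
  | true :: w, 0 => w.count false
  | true :: w, c + 1 => falsesAfter w c
  | false :: w, c => falsesAfter w c

theorem falsesAfter_le (w : List Bool) (c : ℕ) : falsesAfter w c ≤ w.count false := by
  induction w generalizing c with
  | nil => simp [falsesAfter]
  | cons b w ih =>
    cases b
    · simpa [falsesAfter] using (ih c).trans (Nat.le_succ _)
    · cases c with
      | zero => simp [falsesAfter]
      | succ c => simpa [falsesAfter] using ih c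

theorem falsesAfter_eq_zero (w : List Bool) (c : ℕ) (h : w.count true ≤ c) :
    falsesAfter w c = 0 := by
  induction w generalizing c with
  | nil => rfl
  | cons b w ih =>
    cases b
    · exact ih c (by simpa using h)
    · cases c with
      | zero => simp at h
      | succ c => exact ih c (by simpa using h)

theorem falsesAfter_succ_le (w : List Bool) (c : ℕ) :
    falsesAfter w (c + 1) ≤ falsesAfter w c := by
  induction w generalizing c with
  | nil => rfl
  | cons b w ih =>
    cases b
    · exact ih c
    · cases c with
      | zero => exact falsesAfter_le w 0
      | succ c => exact ih c

theorem falsesAfter_injective {w w' : List Bool} (ht : w.count true = w'.count true)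
    (hf : w.count false = w'.count false) (h : falsesAfter w = falsesAfter w') : w = w' := by
  induction w generalizing w' with
  | nil =>
    have := count_true_add_count_false w'
    rw [← ht, ← hf] at this
    exact (List.length_eq_zero_iff.1 this.symm).symm
  | cons b w ih =>
    cases w' with
    | nil => cases b <;> simp at ht hf
    | cons b' w' =>
      have h0 := congrFun h 0
      cases b <;> cases b'
      · exact congrArg _ (ih (by simpa using ht) (by simpa using hf) h)
      · have := falsesAfter_le w 0
        simp [falsesAfter] at h0 hf
        omega
      · have := falsesAfter_le w' 0
        simp [falsesAfter] at h0 hf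
        omega
      · exact congrArg _
          (ih (by simpa using ht) (by simpa using hf) (funext fun c => congrFun h (c + 1)))

theorem exists_falsesAfter_eq (n s : ℕ) (B : ℕ → ℕ) (hB : ∀ c, B (c + 1) ≤ B c)
    (hn : ∀ c, B c ≤ n) (hs : ∀ c, s ≤ c → B c = 0) :
    ∃ w : List Bool, w.count true = s ∧ w.count false = n ∧ falsesAfter w = B := by
  obtain ⟨N, hN⟩ : ∃ N, n + s = N := ⟨_, rfl⟩
  induction N generalizing n s B with
  | zero =>
    obtain ⟨rfl, rfl⟩ : n = 0 ∧ s = 0 := by omega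
    exact ⟨[], rfl, rfl, funext fun c => (hs c (Nat.zero_le c)).symm⟩
  | succ N ih =>
    by_cases h : 0 < s ∧ B 0 = n
    · obtain ⟨s, rfl⟩ : ∃ s', s = s' + 1 := ⟨s - 1, by omega⟩
      obtain ⟨w, h1, h2, h3⟩ := ih n s (fun c => B (c + 1)) (fun c => hB (c + 1))
        (fun c => hn (c + 1)) (fun c hc => hs (c + 1) (by omega)) (by omega)
      refine ⟨true :: w, by simpa using h1, by simpa using h2, funext fun c => ?_⟩
      cases c with
      | zero => rw [h.2, ← h2]; rfl
      | succ c => exact congrFun h3 c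
    · have h0 : B 0 < n := by
        have h1 := hn 0
        have h2 := hs 0
        omega
      obtain ⟨n, rfl⟩ : ∃ n', n = n' + 1 := ⟨n - 1, by omega⟩
      obtain ⟨w, h1, h2, h3⟩ := ih n s B hB
        (fun c => (antitone_nat_of_succ_le hB (Nat.zero_le c)).trans (by omega)) hs (by omega)
      exact ⟨false :: w, by simpa using h1, by simpa using h2, h3⟩

/-- The positions of the letters `true` in terms of the numbers of subsequent letters `false`. -/
theorem lt_count_take_iff {w : List Bool} {c : ℕ} (hc : c < w.count true) (t : ℕ) :
    c < (w.take t).count true ↔ c + w.count false < t + falsesAfter w c := by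
  induction w generalizing c t with
  | nil => simp at hc
  | cons b w ih =>
    have hle := falsesAfter_le (b :: w) c
    cases t with
    | zero =>
      simp
      omega
    | succ t =>
      cases b
      · have := ih (c := c) (by simpa using hc) t
        simp [falsesAfter] at this ⊢
        omega
      · cases c with
        | zero =>
          simp [falsesAfter]
        | succ c =>
          have := ih (c := c) (by simpa using hc) t
          simp [falsesAfter] at this ⊢
          omega

theorem forall_falses_le_iff {n s : ℕ} {w w' : List Bool}
    (hw : w.count true = s ∧ w.count false = n) (hw' : w'.count true = s ∧ w'.count false = n) :
    (∀ t, falses w' t ≤ falses w (t + 1)) ↔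
      ∀ c, falsesAfter w (c + 1) ≤ falsesAfter w' c := by
  have hlen : w.length = n + s := by rw [← count_true_add_count_false, hw.1, hw.2, add_comm]
  have hlen' : w'.length = n + s := by rw [← count_true_add_count_false, hw'.1, hw'.2, add_comm]
  constructor
  · intro h c
    rcases lt_or_ge (c + 1) s with hc | hc
    · by_contra hlt
      have hle := falsesAfter_le w (c + 1)
      rw [hw.2] at hle
      -- `t` is the position of the letter `true` of `w` with index `c + 1`
      obtain ⟨t, ht⟩ : ∃ t, t + falsesAfter w (c + 1) = c + 1 + n :=
        ⟨c + 1 + n - falsesAfter w (c + 1), by omega⟩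
      have h1 := lt_count_take_iff (w := w) (c := c + 1) (by omega) (t + 1)
      have h2 := lt_count_take_iff (w := w') (c := c) (by omega) t
      have h3 := falses_add_count_take w (t + 1)
      have h4 := falses_add_count_take w' t
      have h5 := h t
      rw [hw.2] at h1
      rw [hw'.2] at h2
      rcases lt_or_ge t (n + s) with htl | htl
      · omega
      · rw [List.take_of_length_le (by omega), hw'.1] at h2
        omega
    · rw [falsesAfter_eq_zero w _ (by omega)]
      exact Nat.zero_le _
  · intro h t
    rcases lt_or_ge t (n + s) with htl | htl
    · have h3 := falses_add_count_take w (t + 1)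
      have h4 := falses_add_count_take w' t
      have h5 : (w.take (t + 1)).count true ≤ s := hw.1 ▸ (List.take_sublist _ w).count_le _
      by_cases h1 : (w.take (t + 1)).count true ≤ 1
      · omega
      · obtain ⟨c, hc⟩ : ∃ c, (w.take (t + 1)).count true = c + 2 :=
          ⟨(w.take (t + 1)).count true - 2, by omega⟩
        have h6 := (lt_count_take_iff (w := w) (c := c + 1) (by omega) (t + 1)).1 (by omega)
        have h7 := lt_count_take_iff (w := w') (c := c) (by omega) t
        have h8 := h c
        rw [hw.2] at h6
        rw [hw'.2] at h7
        omega
    · rw [falses_of_length_le (w := w) (by omega), hw.2, ← hw'.2]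
      exact falses_le_count w' t

/-- Periodic arrays of non-negative integers which are at most `n`, whose rows have `s` entries
(continued by `0`) and are weakly decreasing, and such that each row dominates the preceding one,
shifted by one unit. -/
def periodicArrays (m n s : ℕ) : Set (ℤ → ℕ → ℕ) :=
  {B | (∀ i c, B i (c + 1) ≤ B i c) ∧ (∀ i c, B i c ≤ n) ∧ (∀ i c, s ≤ c → B i c = 0) ∧
    (∀ i c, B i (c + 1) ≤ B (i + 1) c) ∧ ∀ i, B (i + m) = B i}

theorem nonempty_words_equiv_arrays (m n s : ℕ) :
    Nonempty (periodicWords m n s ≃ periodicArrays m n s) := by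
  refine ⟨Equiv.ofBijective (fun w => ⟨fun i => falsesAfter (w.1 i), ?_⟩) ⟨?_, ?_⟩⟩
  · obtain ⟨w, hw, hd, hper⟩ := w
    refine ⟨fun i => falsesAfter_succ_le _, fun i c => ?_, fun i c hc => ?_, fun i => ?_,
      fun i => congrArg falsesAfter (hper i)⟩
    · exact (falsesAfter_le (w i) c).trans_eq (hw i).2
    · exact falsesAfter_eq_zero _ c ((hw i).1.trans_le hc)
    · exact (forall_falses_le_iff (hw i) (hw (i + 1))).1 (hd i)
  · intro w w' h
    refine Subtype.ext (funext fun i => ?_)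
    have hw := w.2.1 i
    have hw' := w'.2.1 i
    exact falsesAfter_injective (hw.1.trans hw'.1.symm) (hw.2.trans hw'.2.symm)
      (congrFun (congrArg Subtype.val h) i)
  · rintro ⟨B, h1, h2, h3, h4, h5⟩
    choose w ht hf hB using fun i => exists_falsesAfter_eq n s (B i) (h1 i) (h2 i) (h3 i)
    refine ⟨⟨w, fun i => ⟨ht i, hf i⟩, fun i => ?_, fun i => ?_⟩, Subtype.ext (funext hB)⟩
    · rw [forall_falses_le_iff ⟨ht i, hf i⟩ ⟨ht (i + 1), hf (i + 1)⟩, hB, hB]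
      exact h4 i
    · exact falsesAfter_injective ((ht _).trans (ht i).symm) ((hf _).trans (hf i).symm)
        (by rw [hB, hB, h5])

/-! ### Arrays and cylindric partitions -/

theorem mem_stairs_iff (m s i j : ℕ) : (i, j) ∈ stairs m s ↔ i < m ∧ j < s + (m - 1 - i) := by
  rw [stairs, YoungDiagram.mem_ofRowLens]
  simp

theorem CylindricPartition.entry_injective {lam mu : YoungDiagram} {d : ℕ} :
    Function.Injective (CylindricPartition.entry (lam := lam) (mu := mu) (d := d)) := by
  rintro ⟨e, _, _, _, _⟩ ⟨e', _, _, _, _⟩ h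
  cases h
  rfl

theorem colLen_stairs {m s : ℕ} (hs : 0 < s) : (stairs m s).colLen 0 = m := by
  refine eq_of_forall_lt_iff fun i => ?_
  rw [← YoungDiagram.mem_iff_lt_colLen, mem_stairs_iff]
  omega

theorem periodicArrays_shift {m n s : ℕ} {B : ℤ → ℕ → ℕ} (hB : B ∈ periodicArrays m n s)
    (d : ℕ) (i : ℤ) (c : ℕ) : B i (c + d) ≤ B (i + d) c := by
  induction d generalizing c with
  | zero => simp
  | succ d ih =>
    have h1 := ih (c + 1)
    have h2 := hB.2.2.2.1 (i + d) c
    rw [show c + (d + 1) = c + 1 + d by ring,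
      show i + ((d + 1 : ℕ) : ℤ) = i + d + 1 by push_cast; ring]
    exact h1.trans h2

/-- The filling of the skew diagram whose rows, read from the bottom to the top, are rows of a
periodic array. -/
def arrayEntry (m : ℕ) (B : ℤ → ℕ → ℕ) (c : ℕ × ℕ) : ℕ :=
  if c.1 < m ∧ m - 1 - c.1 ≤ c.2 then B (m - 1 - c.1 : ℕ) (c.2 - (m - 1 - c.1)) else 0

theorem arrayEntry_of_le {m : ℕ} {B : ℤ → ℕ → ℕ} {i j : ℕ} (hi : i < m) (hj : m - 1 - i ≤ j) :
    arrayEntry m B (i, j) = B (m - 1 - i : ℕ) (j - (m - 1 - i)) := if_pos ⟨hi, hj⟩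

/-- The cylindric partition of a periodic array. -/
def arrayPartition {m n s : ℕ} {B : ℤ → ℕ → ℕ} (hB : B ∈ periodicArrays m n s) :
    CylindricPartition (stairs m s) (stairs m 0) m where
  entry := arrayEntry m B
  zero_outside := by
    rintro ⟨i, j⟩ h
    simp only [mem_stairs_iff, zero_add] at h
    by_cases hc : i < m ∧ m - 1 - i ≤ j
    · rw [arrayEntry_of_le hc.1 hc.2]
      exact hB.2.2.1 _ _ (by omega)
    · exact if_neg hc
  row_weak := by
    intro i j j' hj h1 h2 h3 h4
    simp only [mem_stairs_iff, zero_add] at h1 h2 h3 h4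
    rw [arrayEntry_of_le (by omega) (by omega), arrayEntry_of_le (by omega) (by omega)]
    exact antitone_nat_of_succ_le (hB.1 _) (by omega)
  col_weak := by
    intro i i' j hi h1 h2 h3 h4
    simp only [mem_stairs_iff, zero_add] at h1 h2 h3 h4
    rw [arrayEntry_of_le (by omega) (by omega), arrayEntry_of_le (by omega) (by omega)]
    have h := periodicArrays_shift hB (i' - i) (m - 1 - i' : ℕ) (j - (m - 1 - i))
    convert h using 2 <;> omega
  wrap_weak := by
    intro b i j hb h1 h2 h3 h4
    simp only [mem_stairs_iff, zero_add] at h1 h2 h3 h4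
    rw [colLen_stairs (by omega)] at hb
    rw [arrayEntry_of_le (by omega) (by omega), arrayEntry_of_le (by omega) (by omega)]
    have h := periodicArrays_shift hB (i + 1) (m - 1 - i : ℕ) j
    have h0 := hB.2.2.2.2 0
    have h5 : ((m - 1 - i : ℕ) : ℤ) + ((i + 1 : ℕ) : ℤ) = 0 + m := by omega
    rw [h5, h0] at h
    convert h using 2 <;> omega

/-- The periodic array of a filling of the skew diagram. -/
def entryArray (m : ℕ) (e : ℕ × ℕ → ℕ) (i : ℤ) (c : ℕ) : ℕ :=
  e (m - 1 - (i % m).toNat, (i % m).toNat + c)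

theorem entryArray_mem_periodicArrays {m n s : ℕ} (hm : 1 ≤ m)
    {π : CylindricPartition (stairs m s) (stairs m 0) m}
    (hπ : π ∈ boundedCylindricPartitions m n s) :
    entryArray m π.entry ∈ periodicArrays m n s := by
  have hrange : ∀ i : ℤ, (i % m).toNat < m ∧ (((i % m).toNat : ℕ) : ℤ) = i % m := fun i => by
    have h1 := Int.emod_nonneg i (b := m) (by omega)
    have h2 := Int.emod_lt_of_pos i (b := m) (by omega)
    omega
  have hzero : ∀ (i : ℤ) c, s ≤ c → entryArray m π.entry i c = 0 := fun i c hc => by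
    refine π.zero_outside _ ?_
    have := hrange i
    simp only [mem_stairs_iff, zero_add]
    omega
  refine ⟨fun i c => ?_, fun i c => hπ _, hzero, fun i c => ?_, fun i => ?_⟩
  · rcases lt_or_ge (c + 1) s with hc | hc
    · have := hrange i
      refine π.row_weak _ _ _ (by omega) ?_ ?_ ?_ ?_ <;> rw [mem_stairs_iff] <;> omega
    · rw [hzero i _ hc]
      exact Nat.zero_le _
  · rcases lt_or_ge (c + 1) s with hc | hc
    · have h1 := hrange i
      have h2 := hrange (i + 1)
      by_cases h : (i % m).toNat + 1 < m
      · have h3 : ((i + 1) % m).toNat = (i % m).toNat + 1 := by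
          have h4 : (i + 1) % m = i % m + 1 := by
            rw [← Int.emod_add_emod, Int.emod_eq_of_lt (by omega) (by omega)]
          omega
        rw [entryArray, entryArray, h3, add_assoc _ 1 c, add_comm 1 c]
        refine π.col_weak _ _ _ (by omega) ?_ ?_ ?_ ?_ <;> rw [mem_stairs_iff] <;> omega
      · have h3 : ((i + 1) % m).toNat = 0 := by
          have h4 : (i + 1) % m = 0 := by
            rw [← Int.emod_add_emod, show i % m + 1 = (m : ℤ) by omega, Int.emod_self]
          omega
        rw [entryArray, entryArray, h3, show (i % m).toNat + (c + 1) = 0 + c + m by omega]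
        refine π.wrap_weak _ _ _ ?_ ?_ ?_ ?_ ?_
        · rw [colLen_stairs (by omega)]
          omega
        all_goals rw [mem_stairs_iff]; omega
    · rw [hzero i _ hc]
      exact Nat.zero_le _
  · funext c
    simp [entryArray]

theorem nonempty_arrays_equiv_partitions {m : ℕ} (n s : ℕ) (hm : 1 ≤ m) :
    Nonempty (periodicArrays m n s ≃ boundedCylindricPartitions m n s) := by
  refine ⟨⟨fun B => ⟨arrayPartition B.2, fun c => ?_⟩,
    fun π => ⟨entryArray m π.1.entry, entryArray_mem_periodicArrays hm π.2⟩, fun B => ?_,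
    fun π => ?_⟩⟩
  · change arrayEntry m B.1 c ≤ n
    rw [arrayEntry]
    split_ifs
    · exact B.2.2.1 _ _
    · exact Nat.zero_le n
  · refine Subtype.ext (funext fun i => funext fun c => ?_)
    have h1 := Int.emod_nonneg i (b := m) (by omega)
    have h2 := Int.emod_lt_of_pos i (b := m) (by omega)
    have h3 : B.1 (i % m) = B.1 i := by
      have h := Function.Periodic.int_mul (f := B.1) (c := (m : ℤ)) B.2.2.2.2.2 (i / m) (i % m)
      rwa [Int.cast_id, mul_comm, Int.emod_add_mul_ediv, eq_comm] at h
    change arrayEntry m B.1 (m - 1 - (i % m).toNat, (i % m).toNat + c) = B.1 i c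
    rw [arrayEntry_of_le (by omega) (by omega),
      show m - 1 - (m - 1 - (i % m).toNat) = (i % m).toNat by omega, Int.toNat_of_nonneg h1,
      Nat.add_sub_cancel_left, h3]
  · refine Subtype.ext (CylindricPartition.entry_injective (funext fun c => ?_))
    obtain ⟨i, j⟩ := c
    change arrayEntry m (entryArray m π.1.entry) (i, j) = _
    by_cases h : i < m ∧ m - 1 - i ≤ j
    · have h1 : ((m - 1 - i : ℕ) : ℤ) % m = (m - 1 - i : ℕ) :=
        Int.emod_eq_of_lt (by omega) (by omega)
      rw [arrayEntry_of_le h.1 h.2, entryArray, h1, Int.toNat_natCast]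
      congr 2 <;> omega
    · rw [arrayEntry, if_neg h]
      refine (π.1.zero_outside _ ?_).symm
      simp only [mem_stairs_iff, zero_add]
      omega

end Cliff

theorem proposition4p2 (m n s : ℕ) (hm : 1 ≤ m) :
    Nonempty (Cliff.periodicCliffs m n s ≃ Cliff.periodicTilings m (2 * n + s) s) ∧
    Nonempty (Cliff.periodicTilings m (2 * n + s) s ≃
      Cliff.matchingsWithVertical m (2 * n + s) (m * s)) ∧
    Nonempty (Cliff.periodicTilings m (2 * n + s) s ≃
      Cliff.periodicPathFamilies m (2 * n + s) s) ∧
    Nonempty (Cliff.periodicPathFamilies m (2 * n + s) s ≃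
      Cliff.boundedCylindricPartitions m n s) := by
  have : NeZero m := ⟨by omega⟩
  refine ⟨Cliff.nonempty_cliffs_equiv_tilings m n s,
    Cliff.nonempty_tilings_equiv_matchings (2 * n + s) s,
    Cliff.nonempty_tilings_equiv_families m n s, ?_⟩
  obtain ⟨e⟩ := Cliff.nonempty_families_equiv_words m n s
  obtain ⟨e'⟩ := Cliff.nonempty_words_equiv_arrays m n s
  obtain ⟨e''⟩ := Cliff.nonempty_arrays_equiv_partitions n s hm
  exact ⟨(e.trans e').trans e''⟩
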